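/- Let $\mathbb F_q$ be a finite field with $q$ elements, $K$ a finite extension of the rational function field $\mathbb F_q(\theta)$, $|\cdot|$ a nonarchimedean absolute value on $K$ with $|\theta|=q$, $K_\infty$ the completion of $K$, and $\mathbb C_\infty$ the completion of an algebraic closure of $K_\infty$. Let $\mathbb T\subset\mathbb C_\infty[[t]]$ be the Tate algebra of power series converging on $|t|\le 1$, and put $\tau(\sum_i x_it^i)=\sum_i x_i^q t^i$, applied entrywise to matrices. Let $(E,\phi)$ be a $t$-module over $K$ of dimension $d$, i.e. $E\cong\mathbb G_{a,K}^d$ with an $\mathbb F_q$-linear endomorphism $\phi_t$ such that $d\phi_t-\theta$ is nilpotent on $\mathrm{Lie}(E)$. Let $\exp_E=\sum_{n\ge0} e_n\tau^n$ ($e_0=1$) be its exponential, determined by $\exp_E\circ d\phi_t=\phi_t\circ\exp_E$, and let $\Lambda=\ker(\exp_E)\subset\mathrm{Lie}(E)(\mathbb C_\infty)$ be its period lattice, an $\mathbb F_q[t]$-module via $d\phi$. Let $\mathsf M=\mathrm{Hom}_{\mathbb F_q}(E,\mathbb G_{a,K})$ be the $t$-motive of $E$, where $t$ acts by $m\mapsto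 m\circ\phi_t$, $K$ by scalar multiplication on $\mathbb G_a$, and $\tau$ by composition with the $q$-Frobenius of $\mathbb G_a$. Assume that $E$ is abelian and uniformizable: $\mathsf M$ has a finite $K[t]$-basis $\mathbf m=(m_1,\dots,m_r)^{\mathrm{tr}}$, with $\tau(\mathbf m)=\Theta\,\mathbf m$ for $\Theta\in\mathrm{Mat}_{r\times r}(K[t])$, and there is a rigid analytic trivialization $\Upsilon\in\mathrm{GL}_r(\mathbb T)$, i.e. $\tau(\Upsilon)\,\Theta=\Upsilon$; fix such $\mathbf m$ and $\Upsilon$. Let $\kappa_1,\dots,\kappa_d\in\mathsf M$ be the coordinate functions of an isomorphism $E\cong\mathbb G_{a,K}^d$ (of algebraic groups with $\mathbb F_q$-action), $B\in\mathrm{GL}_r(K[t])$, and $A'\in\mathrm{Mat}_{d\times r}(K(t))$ a matrix each row of which has the form $(t-\theta)^{-\gamma}s_i$ for some integer $\gamma>0$ and some standard basis row vector $s_i$, such that $$(\kappa_1,\dots,\kappa_d)^{\mathrm{tr}}=A'B\Theta\cdot\mathbf m$$ (in particular $A'B\Theta$ has entries in $K[t]$). Then the entries of $A'B\Theta\Upsilon^{-1}$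 are expansions at $t=0$ of functions that are meromorphic on a closed disc around $0$ of radius $>|\theta|$, and the columns of the matrix $$\mathrm{res}_{t=\theta}\left(A'B\Theta\Upsilon^{-1}\,dt\right)$$ are, in the coordinates on $\mathrm{Lie}(E)(\mathbb C_\infty)$ induced by $\kappa_1,\dots,\kappa_d$, an $\mathbb F_q[t]$-basis of the period lattice $\Lambda$. -/

import Mathlib

open scoped Polynomial PowerSeries

noncomputable section

namespace PeriodResidue

/-! ### The field `C_∞` -/

section BaseField

/-- The image `θ ∈ K` of the variable of the rational function field `𝔽_q(θ)`. -/
def theta (Fq K : Type*) [Field Fq] [Field K] [Algebra (RatFunc Fq) K] : K :=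
  algebraMap (RatFunc Fq) K RatFunc.X

/-- A nonarchimedean absolute value on `K` with `|θ| = q`. Its restriction to `𝔽_q(θ)` is then the
absolute value `q ^ deg` at the infinite place. -/
structure InftyAbs (Fq K : Type*) [Field Fq] [Fintype Fq] [Field K] [Algebra (RatFunc Fq) K] where
  abv : AbsoluteValue K ℝ
  nonarch : IsNonarchimedean abv
  abv_theta : abv (theta Fq K) = Fintype.card Fq

variable {Fq K : Type*} [Field Fq] [Fintype Fq] [Field K] [Algebra (RatFunc Fq) K]
  (P : InftyAbs Fq K)

/-- `K_∞`, the completion of `K` at the chosen infinite place. -/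
def KInf : Type _ := P.abv.Completion

instance : NormedField (KInf P) := inferInstanceAs (NormedField P.abv.Completion)

instance : CompleteSpace (KInf P) := inferInstanceAs (CompleteSpace P.abv.Completion)

/-- The embedding `K → K_∞`. -/
def toKInf : K →+* KInf P :=
  (UniformSpace.Completion.coeRingHom (α := WithAbs P.abv)).comp
    (WithAbs.equiv P.abv).symm.toRingHom

theorem norm_toKInf (x : K) : ‖toKInf P x‖ = P.abv x :=
  UniformSpace.Completion.norm_coe (E := WithAbs P.abv) _

instance : IsUltrametricDist (KInf P) := by
  refine IsUltrametricDist.isUltrametricDist_of_forall_norm_add_le_max_norm fun x y => ?_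
  refine UniformSpace.Completion.induction_on₂ (α := WithAbs P.abv) (β := WithAbs P.abv)
    (p := fun x y => ‖x + y‖ ≤ max ‖x‖ ‖y‖) x y ?_ ?_
  · exact isClosed_le (by fun_prop) (by fun_prop)
  · intro a b
    rw [← UniformSpace.Completion.coe_add]
    simp only [UniformSpace.Completion.norm_coe]
    exact P.nonarch _ _

instance : NontriviallyNormedField (KInf P) where
  non_trivial := ⟨toKInf P (theta Fq K), by
    rw [norm_toKInf, P.abv_theta]
    exact_mod_cast Fintype.one_lt_card⟩

/-- The algebraic closure of `K_∞`, with the unique extension of the absolute value. -/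
def KInfBar : Type _ := AlgebraicClosure (KInf P)

instance : Field (KInfBar P) := inferInstanceAs (Field (AlgebraicClosure (KInf P)))

instance : Algebra (KInf P) (KInfBar P) :=
  inferInstanceAs (Algebra (KInf P) (AlgebraicClosure (KInf P)))

instance : Algebra.IsAlgebraic (KInf P) (KInfBar P) :=
  inferInstanceAs (Algebra.IsAlgebraic (KInf P) (AlgebraicClosure (KInf P)))

instance : NormedField (KInfBar P) := spectralNorm.normedField (KInf P) (KInfBar P)

instance : IsUltrametricDist (KInfBar P) :=
  IsUltrametricDist.isUltrametricDist_of_forall_norm_add_le_max_norm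
    (isNonarchimedean_spectralNorm (K := KInf P) (L := KInfBar P))

/-- `C_∞`, the completion of the algebraic closure of `K_∞`. -/
def CInf : Type _ := UniformSpace.Completion (KInfBar P)

instance : NormedField (CInf P) :=
  inferInstanceAs (NormedField (UniformSpace.Completion (KInfBar P)))

instance : CompleteSpace (CInf P) :=
  inferInstanceAs (CompleteSpace (UniformSpace.Completion (KInfBar P)))

instance : IsUltrametricDist (CInf P) := by
  refine IsUltrametricDist.isUltrametricDist_of_forall_norm_add_le_max_norm fun x y => ?_
  refine UniformSpace.Completion.induction_on₂ (α := KInfBar P) (β := KInfBar P)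
    (p := fun x y => ‖x + y‖ ≤ max ‖x‖ ‖y‖) x y ?_ ?_
  · exact isClosed_le (by fun_prop) (by fun_prop)
  · intro a b
    rw [← UniformSpace.Completion.coe_add]
    simp only [UniformSpace.Completion.norm_coe]
    exact IsUltrametricDist.norm_add_le_max a b

instance : Algebra K (CInf P) :=
  ((UniformSpace.Completion.coeRingHom (α := KInfBar P)).comp
    ((algebraMap (KInf P) (KInfBar P)).comp (toKInf P))).toAlgebra

/-- The absolute value of `C_∞` extends the one of `K`. -/
theorem norm_algebraMap_CInf (x : K) : ‖algebraMap K (CInf P) x‖ = P.abv x :=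
  (UniformSpace.Completion.norm_coe (E := KInfBar P) _).trans
    ((spectralNorm_extends (K := KInf P) (L := KInfBar P) (toKInf P x)).trans (norm_toKInf P x))

end BaseField

/-! ### Tate algebra, twisting, residues -/

section Series

variable (C : Type*) [NormedField C]

/-- The Tate algebra of power series over `C` converging on the closed unit disc. -/
def tate [IsUltrametricDist C] : Subring C⟦X⟧ := PowerSeries.IsRestricted.subring 1

variable {C}

/-- The twist `∑ xᵢ tⁱ ↦ ∑ xᵢ ^ q tⁱ`. -/
def twist (q : ℕ) (f : C⟦X⟧) : C⟦X⟧ := PowerSeries.mk fun i => (PowerSeries.coeff i f) ^ q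

/-- The expansion of `g` in powers of `t - a`, for `g` converging on a closed disc around `0` whose
radius is at least `|a|`: the `k`-th coefficient is the value at `a` of the `k`-th
hyperderivative of `g`. -/
def taylorAt (a : C) (g : C⟦X⟧) : C⟦X⟧ :=
  PowerSeries.mk fun k =>
    ∑' i : ℕ, ((i + k).choose k : C) * PowerSeries.coeff (i + k) g * a ^ i

/-- `f` is the expansion at `t = 0` of a function `g / h` that is meromorphic on a closed disc
around `0` of radius `ρ > |a|`, and `c` is the coefficient of `(t - a)⁻¹` in the Laurent expansion
of this function at `t = a`, i.e. `c = res_{t = a} (f dt)`. -/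
def HasResidueAt (f : LaurentSeries C) (a c : C) : Prop :=
  ∃ ρ : ℝ, ‖a‖ < ρ ∧ ∃ g h : C⟦X⟧,
    PowerSeries.IsRestricted ρ g ∧ PowerSeries.IsRestricted ρ h ∧ h ≠ 0 ∧
    HahnSeries.ofPowerSeries ℤ C h * f = HahnSeries.ofPowerSeries ℤ C g ∧
    (HahnSeries.ofPowerSeries ℤ C (taylorAt a g) /
      HahnSeries.ofPowerSeries ℤ C (taylorAt a h)).coeff (-1) = c

theorem polyToLaurent_injective (K C : Type*) [Field K] [NormedField C] [Algebra K C] :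
    Function.Injective ((HahnSeries.ofPowerSeries ℤ C).comp
      ((Polynomial.coeToPowerSeries.ringHom (R := C)).comp
        (Polynomial.mapRingHom (algebraMap K C)))) := by
  rw [RingHom.coe_comp, RingHom.coe_comp]
  exact HahnSeries.ofPowerSeries_injective.comp ((Polynomial.coe_injective C).comp
    (Polynomial.map_injective _ (algebraMap K C).injective))

/-- The embedding `K(t) → C((t))`. -/
def ratToLaurent (K C : Type*) [Field K] [NormedField C] [Algebra K C] :
    RatFunc K →+* LaurentSeries C :=
  RatFunc.liftRingHom _
    (nonZeroDivisors_le_comap_nonZeroDivisors_of_injective _ (polyToLaurent_injective K C))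

end Series

/-! ### `t`-modules, their motives and their period lattices -/

section TModules

/-- The `𝔽_q`-linear homomorphisms of algebraic groups `𝔾_a ^ d → 𝔾_a` over `K`, that is, the
`𝔽_q`-linear polynomials `∑ a_{ij} X_j ^ (q ^ i)`. Composition is substitution of polynomials. -/
def homGa (Fq K : Type*) [Fintype Fq] [Field K] (d : ℕ) :
    Submodule K (MvPolynomial (Fin d) K) :=
  Submodule.span K {f | ∃ (j : Fin d) (i : ℕ), f = MvPolynomial.X j ^ (Fintype.card Fq ^ i)}

/-- The differential at the origin of a homomorphism `𝔾_a ^ d → 𝔾_a ^ n`, as a matrix. -/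
def differential {K : Type*} [Field K] {d n : ℕ} (f : Fin n → MvPolynomial (Fin d) K) :
    Matrix (Fin n) (Fin d) K :=
  Matrix.of fun i j => MvPolynomial.coeff (Finsupp.single j 1) (f i)

/-- A `t`-module of dimension `d` over `K`, of generic characteristic `t ↦ θ`. The group is
`E = 𝔾_a ^ d`, and the `𝔽_q[t]`-action is given by the endomorphism `φ_t`, an arbitrary
`𝔽_q`-linear endomorphism of `E` for which `dφ_t - θ` is nilpotent. -/
structure TModule (Fq K : Type*) [Field Fq] [Fintype Fq] [Field K] [Algebra (RatFunc Fq) K]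
    (d : ℕ) where
  phi : Fin d → MvPolynomial (Fin d) K
  phi_mem : ∀ i, phi i ∈ homGa Fq K d
  nilp : IsNilpotent (differential phi - theta Fq K • (1 : Matrix (Fin d) (Fin d) K))

variable {Fq K : Type*} [Field Fq] [Fintype Fq] [Field K]

theorem exists_pow_eq_iterateFrobenius (Fq K : Type*) [Field Fq] [Fintype Fq] [Field K]
    [Algebra (RatFunc Fq) K] :
    ∃ (p f : ℕ) (_ : ExpChar K p), Fintype.card Fq = p ^ f := by
  obtain ⟨p, hp⟩ := CharP.exists Fq
  obtain ⟨f, hpr, hf⟩ := FiniteField.card Fq p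
  have := Fact.mk hpr
  have : CharP K p := charP_of_injective_ringHom
    ((algebraMap (RatFunc Fq) K).comp (algebraMap Fq (RatFunc Fq))).injective p
  exact ⟨p, f, inferInstance, hf⟩

variable [Algebra (RatFunc Fq) K] {d : ℕ}

theorem pow_mem_homGa {f : MvPolynomial (Fin d) K} (hf : f ∈ homGa Fq K d) :
    f ^ Fintype.card Fq ∈ homGa Fq K d := by
  obtain ⟨p, n, hp, hq⟩ := exists_pow_eq_iterateFrobenius Fq K
  induction hf using Submodule.span_induction with
  | mem x hx =>
    obtain ⟨j, i, rfl⟩ := hx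
    exact Submodule.subset_span ⟨j, i + 1, by rw [← pow_mul, pow_succ]⟩
  | zero => rw [zero_pow Fintype.card_ne_zero]; exact Submodule.zero_mem _
  | add x y _ _ hx hy =>
    have : (x + y) ^ Fintype.card Fq = x ^ Fintype.card Fq + y ^ Fintype.card Fq := by
      rw [hq]
      exact add_pow_expChar_pow x y p n
    rw [this]
    exact Submodule.add_mem _ hx hy
  | smul a x _ hx => rw [_root_.smul_pow]; exact Submodule.smul_mem _ _ hx

theorem bind_mem_homGa {n : ℕ} {g : Fin n → MvPolynomial (Fin d) K}
    (hg : ∀ i, g i ∈ homGa Fq K d) {f : MvPolynomial (Fin n) K} (hf : f ∈ homGa Fq K n) :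
    MvPolynomial.bind₁ g f ∈ homGa Fq K d := by
  induction hf using Submodule.span_induction with
  | mem x hx =>
    obtain ⟨j, i, rfl⟩ := hx
    rw [map_pow, MvPolynomial.bind₁_X_right]
    induction i with
    | zero => simpa using hg j
    | succ i ih => rw [pow_succ, pow_mul]; exact pow_mem_homGa ih
  | zero => rw [map_zero]; exact Submodule.zero_mem _
  | add x y _ _ hx hy => rw [map_add]; exact Submodule.add_mem _ hx hy
  | smul a x _ hx => rw [map_smul]; exact Submodule.smul_mem _ _ hx

namespace TModule

variable (E : TModule Fq K d)

/-- The action `m ↦ m ∘ φ_t` on `Hom(E, 𝔾_a)`. -/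
def tMul : homGa Fq K d →ₗ[K] homGa Fq K d :=
  (MvPolynomial.bind₁ E.phi).toLinearMap.restrict fun _ h => bind_mem_homGa E.phi_mem h

/-- The `t`-motive `Hom(E, 𝔾_a)` of `E`, as a `K[t]`-module: `K` acts by composition with the
scalar multiplications of `𝔾_a`, and `t` by `m ↦ m ∘ φ_t`. -/
abbrev Motive : Type _ := Module.AEval' E.tMul

variable {E} in
/-- The polynomial underlying an element of the motive. -/
def Motive.poly (m : E.Motive) : MvPolynomial (Fin d) K :=
  ((Module.AEval'.of E.tMul).symm m : homGa Fq K d)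

/-- The `τ`-action on the motive: composition with the `q`-power Frobenius of `𝔾_a`. -/
def tau (m : E.Motive) : E.Motive :=
  Module.AEval'.of E.tMul ⟨Motive.poly m ^ Fintype.card Fq, pow_mem_homGa (Subtype.property _)⟩

/-- `κ₁, …, κ_d : E → 𝔾_a` are the components of an isomorphism `E ≅ 𝔾_a ^ d` of algebraic groups
with `𝔽_q`-action. -/
def IsCoordinateSystem (κ : Fin d → E.Motive) : Prop :=
  ∃ ψ : Fin d → MvPolynomial (Fin d) K, (∀ i, ψ i ∈ homGa Fq K d) ∧
    (∀ i, MvPolynomial.bind₁ ψ (κ i).poly = MvPolynomial.X i) ∧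
    (∀ i, MvPolynomial.bind₁ (fun j => (κ j).poly) (ψ i) = MvPolynomial.X i)

/-- The matrix `A_k` in `φ_t = ∑ A_k τ ^ k`; in particular `A_0 = dφ_t`. -/
def phiCoeff (k : ℕ) : Matrix (Fin d) (Fin d) K :=
  Matrix.of fun i j => MvPolynomial.coeff (Finsupp.single j (Fintype.card Fq ^ k)) (E.phi i)

/-- The linear map `X ↦ X * A_0^{(n)} - A_0 * X`, where `A_0^{(n)}` is the `n`-th twist. -/
def sylvester (n : ℕ) : Module.End K (Matrix (Fin d) (Fin d) K) :=
  LinearMap.mulRight K ((E.phiCoeff 0).map (· ^ Fintype.card Fq ^ n)) -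
    LinearMap.mulLeft K (E.phiCoeff 0)

/-- The coefficient matrices of the exponential `e = ∑ e_n τ ^ n` of `E`, the unique solution of
`e_0 = 1`, `e ∘ dφ_t = φ_t ∘ e`. -/
def expCoeff : ℕ → Matrix (Fin d) (Fin d) K
  | 0 => 1
  | n + 1 => Ring.inverse (E.sylvester (n + 1))
      (∑ k : Fin (n + 1), E.phiCoeff (n + 1 - k) *
        (expCoeff k).map (· ^ Fintype.card Fq ^ (n + 1 - k)))
  termination_by n => n
  decreasing_by exact k.2

theorem phiCoeff_zero : E.phiCoeff 0 = differential E.phi := by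
  ext i j
  simp [phiCoeff, differential]

theorem theta_pow_ne (P : InftyAbs Fq K) {n : ℕ} (hn : n ≠ 0) :
    theta Fq K ^ Fintype.card Fq ^ n ≠ theta Fq K := by
  intro h
  have h1 := congrArg P.abv h
  rw [map_pow, P.abv_theta] at h1
  have h2 : Fintype.card Fq ^ Fintype.card Fq ^ n = Fintype.card Fq ^ 1 := by
    rw [pow_one]; exact_mod_cast h1
  have h3 := Nat.pow_right_injective (Fintype.one_lt_card (α := Fq)) h2
  rw [Nat.pow_eq_one] at h3
  rcases h3 with h3 | h3
  · exact absurd h3 (Fintype.one_lt_card (α := Fq)).ne'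
  · exact hn h3

theorem isUnit_sylvester (P : InftyAbs Fq K) {n : ℕ} (hn : n ≠ 0) : IsUnit (E.sylvester n) := by
  obtain ⟨p, f, hp, hq⟩ := exists_pow_eq_iterateFrobenius Fq K
  set q := Fintype.card Fq with hqdef
  let F : K →+* K := iterateFrobenius K p (f * n)
  have hF : ∀ x, F x = x ^ q ^ n := fun x => by
    simp only [F, iterateFrobenius_def, hq, pow_mul]
  set N := differential E.phi - theta Fq K • (1 : Matrix (Fin d) (Fin d) K) with hN
  have hN0 : IsNilpotent N := E.nilp
  have hA : E.phiCoeff 0 = theta Fq K • (1 : Matrix (Fin d) (Fin d) K) + N := by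
    rw [phiCoeff_zero, hN, add_sub_cancel]
  have hAF : (E.phiCoeff 0).map (· ^ q ^ n)
      = (theta Fq K ^ q ^ n) • (1 : Matrix (Fin d) (Fin d) K) + F.mapMatrix N := by
    have : (E.phiCoeff 0).map (· ^ q ^ n) = F.mapMatrix (E.phiCoeff 0) := by
      ext i j; simp [hF]
    rw [this, hA, map_add]
    congr 1
    ext i j
    by_cases h : i = j
    · simp [h, hF]
    · simp [h]
  have hNF : IsNilpotent (F.mapMatrix N) := hN0.map _
  have key : E.sylvester n =
      algebraMap K (Module.End K (Matrix (Fin d) (Fin d) K)) (theta Fq K ^ q ^ n - theta Fq K)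
        + (LinearMap.mulRight K (F.mapMatrix N) - LinearMap.mulLeft K N) := by
    ext1 X
    change X * (E.phiCoeff 0).map (· ^ q ^ n) - E.phiCoeff 0 * X =
      (theta Fq K ^ q ^ n - theta Fq K) • X + (X * F.mapMatrix N - N * X)
    rw [hAF, hA, mul_add, add_mul, mul_smul_comm, smul_mul_assoc, mul_one, one_mul, sub_smul]
    abel
  rw [key]
  refine IsNilpotent.isUnit_add_left_of_commute ?_ ?_ (Algebra.commutes _ _).symm
  · refine Commute.isNilpotent_sub ?_ ?_ ?_
    · exact (LinearMap.commute_mulLeft_right _ _).symm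
    · exact (LinearMap.isNilpotent_mulRight_iff _ _).2 hNF
    · exact (LinearMap.isNilpotent_mulLeft_iff _ _).2 hN0
  · exact (IsUnit.mk0 _ (sub_ne_zero.2 (theta_pow_ne P hn))).map _

/-- The functional equation `e ∘ dφ_t = φ_t ∘ e`, coefficient of `τ ^ n`. -/
theorem expCoeff_spec (P : InftyAbs Fq K) (n : ℕ) :
    E.expCoeff n * (E.phiCoeff 0).map (· ^ Fintype.card Fq ^ n) =
      ∑ k ∈ Finset.range (n + 1), E.phiCoeff (n - k) *
        (E.expCoeff k).map (· ^ Fintype.card Fq ^ (n - k)) := by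
  cases n with
  | zero =>
    simp [expCoeff]
  | succ n =>
    have h := congrArg (fun g => g (∑ k : Fin (n + 1), E.phiCoeff (n + 1 - k) *
        (E.expCoeff k).map (· ^ Fintype.card Fq ^ (n + 1 - k))))
      (Ring.mul_inverse_cancel _ (E.isUnit_sylvester P (Nat.succ_ne_zero n)))
    simp only [Module.End.mul_apply, Module.End.one_apply] at h
    have h' : E.sylvester (n + 1) (E.expCoeff (n + 1)) = _ :=
      (congrArg (E.sylvester (n + 1)) (by rw [expCoeff])).trans h
    change E.expCoeff (n + 1) * (E.phiCoeff 0).map (· ^ Fintype.card Fq ^ (n + 1)) -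
      E.phiCoeff 0 * E.expCoeff (n + 1) = _ at h'
    rw [Finset.sum_range_succ, ← Fin.sum_univ_eq_sum_range (fun k => E.phiCoeff (n + 1 - k) *
        (E.expCoeff k).map (· ^ Fintype.card Fq ^ (n + 1 - k))), ← h']
    have h1 : (E.expCoeff (n + 1)).map (· ^ Fintype.card Fq ^ (n + 1 - (n + 1)))
      = E.expCoeff (n + 1) := by ext; simp
    rw [h1, Nat.sub_self]
    abel

/-- The exponential `Lie(E)(C) → E(C)`, in the coordinates of `E = 𝔾_a ^ d`. -/
def exp (C : Type*) [NormedField C] [Algebra K C] (x : Fin d → C) : Fin d → C :=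
  ∑' n : ℕ, ((E.expCoeff n).map (algebraMap K C)).mulVec (fun i => x i ^ Fintype.card Fq ^ n)

/-- `Lie(E)(C)`. -/
@[nolint unusedArguments]
def Lie (_ : TModule Fq K d) (C : Type*) : Type _ := Fin d → C

instance (C : Type*) [NormedField C] : AddCommGroup (E.Lie C) :=
  inferInstanceAs (AddCommGroup (Fin d → C))

/-- The `𝔽_q[t]`-action `dφ` on `Lie(E)(C)`, as a ring homomorphism to the `C`-linear
endomorphisms. -/
def dphi (C : Type*) [NormedField C] [Algebra K C] : Fq[X] →+* Module.End C (Fin d → C) :=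
  (Polynomial.aeval (Matrix.mulVecLin
    ((differential E.phi).map (algebraMap K C)))).toRingHom.comp
    (Polynomial.mapRingHom
      ((algebraMap K C).comp ((algebraMap (RatFunc Fq) K).comp (algebraMap Fq (RatFunc Fq)))))

instance (C : Type*) [NormedField C] [Algebra K C] : Module Fq[X] (E.Lie C) :=
  Module.compHom (Fin d → C) (E.dphi C)

/-- The period lattice, the kernel of the exponential. -/
def periodLattice (C : Type*) [NormedField C] [Algebra K C] : Set (E.Lie C) :=
  {x | E.exp C x = 0}

/-- The coordinates on `Lie(E)(C)` induced by a coordinate system of `E`. -/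
def lieCoord {C : Type*} [NormedField C] [Algebra K C] (κ : Fin d → E.Motive) (x : E.Lie C) :
    Fin d → C :=
  ((differential fun i => (κ i).poly).map (algebraMap K C)).mulVec x

end TModule

end TModules

end PeriodResidue

end

open PeriodResidue

open PeriodResidue

noncomputable section

namespace PeriodResidue

open Matrix Filter Topology

/-! The bridge between $\Lambda$ and $\Upsilon$ is the Anderson generating function. Write $\partial
= d\phi_t$. A period $l$ gives the torsion points $h_n = \exp_E(\partial^{-n-1} l)$, which tend to
$0$ and satisfy $\phi_t(h_0)=0$, $\phi_t(h_{n+1})=h_n$; hence $x \mapsto \sum_n x(h_n)t^n$ (`agf`)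
is a $K[t]$-linear map from the motive to $\mathbb T$ that carries $\tau$ to the twist.

Conversely, every such map arises from a unique period. The motive is generated by the coordinate
functions under $K$ and $\tau$, so the map is evaluation at a sequence of points
(`eq_pairing_of_tau`); $t$-linearity makes the sequence a torsion system, and since $\exp_E$ is
invertible near $0$ and converges everywhere, the system comes from a period
(`exists_period_of_torsion`). In the basis $\mathbf m$ these maps are the vectors $v$ over $\mathbb
T$ with $\tau(v)=\Theta v$. The columns of $\Upsilon^{-1}$ solve this equation, and for any solution
$v$ the vector $\Upsilon v$ is fixed by the twist, so it has entries in $\mathbb F_q[t]$. The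
columns therefore correspond to an $\mathbb F_q[t]$-basis $l_1,\dots,l_r$ of $\Lambda$
(`exists_basis_periodLattice`).

As $\kappa = A'B\Theta\,\mathbf m$, the entries of $A'B\Theta\Upsilon^{-1}$ are the generating
functions of the $l_j$ evaluated at the $\kappa_i$. The $n$-th coefficient of such a function is
$d\kappa_i(\partial^{-n-1}l_j)$ up to $O(q^{-qn})$, because $\exp_E$ and $\kappa_i$ agree with their
differentials up to order $q$. The error converges beyond $|\theta|$, while the main term is a
rational function with its pole at $\theta$ and residue $-d\kappa_i(l_j)$ (`hasResidueAt_agf`). The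
required basis is thus $-l_1,\dots,-l_r$. -/

/-! ### Frobenius maps and evaluation of `𝔽_q`-linear polynomials -/

section Algebraic

section Frobenius

variable (Fq R : Type*) [Field Fq] [Fintype Fq] [CommRing R] [Algebra Fq R]

/-- The `q ^ n`-power Frobenius. -/
def frob (n : ℕ) : R →ₐ[Fq] R := FiniteField.frobeniusAlgHom Fq R ^ n

variable {R}

theorem frob_apply (n : ℕ) (x : R) : frob Fq R n x = x ^ Fintype.card Fq ^ n := by
  rw [frob, AlgHom.coe_pow, FiniteField.coe_frobeniusAlgHom, pow_iterate]

theorem frob_frob (m n : ℕ) (x : R) : frob Fq R m (frob Fq R n x) = frob Fq R (m + n) x := by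
  rw [frob, frob, frob, pow_add]; rfl

variable (R) in
theorem coe_frob (n : ℕ) : (fun x : R => x ^ Fintype.card Fq ^ n) = frob Fq R n :=
  funext fun x => (frob_apply Fq n x).symm

theorem frob_zero_apply (x : R) : frob Fq R 0 x = x := by simp [frob_apply]

/-- Frobenius on vectors. -/
def frobVec {ι : Type*} (n : ℕ) : (ι → R) →ₗ[Fq] (ι → R) :=
  LinearMap.pi fun i => (frob Fq R n).toLinearMap ∘ₗ LinearMap.proj i

@[simp] theorem frobVec_apply {ι : Type*} (n : ℕ) (x : ι → R) (i : ι) :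
    frobVec Fq n x i = x i ^ Fintype.card Fq ^ n := frob_apply Fq n (x i)

theorem frobVec_frobVec {ι : Type*} (m n : ℕ) (x : ι → R) :
    frobVec Fq m (frobVec Fq n x) = frobVec Fq (m + n) x := by
  ext i
  simp [← pow_mul, ← pow_add, add_comm]

theorem frobVec_mulVec {ι κ : Type*} [Fintype κ] (n : ℕ) (M : Matrix ι κ R) (x : κ → R) :
    frobVec Fq n (M *ᵥ x) = M.map (frob Fq R n) *ᵥ frobVec Fq n x := by
  ext i
  simp only [frobVec_apply, ← frob_apply, mulVec, dotProduct, map_sum, map_mul, map_apply]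

end Frobenius

section Eval

variable {Fq K C : Type*} [Field Fq] [Fintype Fq] [Field K] {d : ℕ}

/-- The expansion is stated for every sufficiently large cutoff, so that finitely many polynomials
can share one range of summation. -/
theorem exists_homGa_expansion {f : MvPolynomial (Fin d) K} (hf : f ∈ homGa Fq K d) :
    ∃ D, ∀ D' ≥ D, f = ∑ k ∈ Finset.range D', ∑ j,
      MvPolynomial.coeff (Finsupp.single j (Fintype.card Fq ^ k)) f •
        MvPolynomial.X j ^ (Fintype.card Fq ^ k) := by
  classical
  induction hf using Submodule.span_induction with
  | mem x hx =>
    obtain ⟨j, i, rfl⟩ := hx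
    refine ⟨i + 1, fun D hD => ?_⟩
    rw [Finset.sum_eq_single i, Finset.sum_eq_single j]
    · simp [MvPolynomial.coeff_X_pow]
    · intro j' _ hj'
      rw [MvPolynomial.coeff_X_pow, if_neg, zero_smul]
      intro h
      rcases (Finsupp.single_eq_single_iff _ _ _ _).1 h with h | h
      · exact hj' h.1.symm
      · exact pow_ne_zero _ Fintype.card_ne_zero h.1
    · simp
    · intro k _ hk
      refine Finset.sum_eq_zero fun j' _ => ?_
      rw [MvPolynomial.coeff_X_pow, if_neg, zero_smul]
      intro h
      rcases (Finsupp.single_eq_single_iff _ _ _ _).1 h with h | h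
      · exact hk (Nat.pow_right_injective (Fintype.one_lt_card (α := Fq)) h.2).symm
      · exact pow_ne_zero _ Fintype.card_ne_zero h.1
    · intro h
      exact absurd (Finset.mem_range.2 (by omega)) h
  | zero => exact ⟨0, fun D _ => by simp⟩
  | add x y _ _ hx hy =>
    obtain ⟨D₁, h₁⟩ := hx
    obtain ⟨D₂, h₂⟩ := hy
    refine ⟨max D₁ D₂, fun D hD => ?_⟩
    conv_lhs => rw [h₁ D (le_of_max_le_left hD), h₂ D (le_of_max_le_right hD)]
    simp only [MvPolynomial.coeff_add, add_smul, Finset.sum_add_distrib]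
  | smul a x _ hx =>
    obtain ⟨D, h⟩ := hx
    refine ⟨D, fun D' hD => ?_⟩
    conv_lhs => rw [h D' hD]
    simp only [MvPolynomial.coeff_smul, Finset.smul_sum, smul_assoc]

variable [CommRing C] [Algebra K C]

theorem exists_aeval_expansion {f : MvPolynomial (Fin d) K} (hf : f ∈ homGa Fq K d) :
    ∃ D, ∀ D' ≥ D, ∀ x : Fin d → C, MvPolynomial.aeval x f = ∑ k ∈ Finset.range D', ∑ j,
      algebraMap K C (MvPolynomial.coeff (Finsupp.single j (Fintype.card Fq ^ k)) f) *
        x j ^ (Fintype.card Fq ^ k) := by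
  obtain ⟨D, h⟩ := exists_homGa_expansion hf
  refine ⟨D, fun D' hD x => ?_⟩
  conv_lhs => rw [h D' hD]
  simp only [map_sum, map_smul, map_pow, MvPolynomial.aeval_X]
  simp only [Algebra.smul_def]

variable [Algebra Fq C]

/-- Evaluation of a homomorphism `𝔾_a ^ d → 𝔾_a` at points. -/
def evalGa {f : MvPolynomial (Fin d) K} (hf : f ∈ homGa Fq K d) : (Fin d → C) →ₗ[Fq] C where
  toFun x := MvPolynomial.aeval x f
  map_add' x y := by
    induction hf using Submodule.span_induction with
    | mem f hf =>
      obtain ⟨j, i, rfl⟩ := hf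
      simp only [map_pow, MvPolynomial.aeval_X, Pi.add_apply, ← frob_apply, map_add]
    | zero => simp
    | add f g _ _ hf hg => rw [map_add, map_add, map_add, hf, hg]; abel
    | smul a f _ hf => rw [map_smul, map_smul, map_smul, hf, smul_add]
  map_smul' c x := by
    rw [RingHom.id_apply]
    induction hf using Submodule.span_induction with
    | mem f hf =>
      obtain ⟨j, i, rfl⟩ := hf
      simp only [map_pow, MvPolynomial.aeval_X, Pi.smul_apply, ← frob_apply, map_smul]
    | zero => simp
    | add f g _ _ hf hg => rw [map_add, map_add, hf, hg, smul_add]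
    | smul a f _ hf =>
      rw [map_smul, map_smul, hf, Algebra.smul_def, Algebra.smul_def, Algebra.smul_def,
        Algebra.smul_def]
      ring

@[simp] theorem evalGa_apply {f : MvPolynomial (Fin d) K} (hf : f ∈ homGa Fq K d)
    (x : Fin d → C) : evalGa hf x = MvPolynomial.aeval x f := rfl

theorem coeff_eq_zero_of_large {f : MvPolynomial (Fin d) K} :
    ∃ D, ∀ k ≥ D, ∀ j : Fin d,
      MvPolynomial.coeff (Finsupp.single j (Fintype.card Fq ^ k)) f = 0 := by
  refine ⟨f.totalDegree + 1, fun k hk j => MvPolynomial.coeff_eq_zero_of_totalDegree_lt ?_⟩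
  rw [← Finsupp.degree_apply, Finsupp.degree_single]
  exact hk.trans (Nat.lt_pow_self (Fintype.one_lt_card (α := Fq))).le

end Eval

theorem map_pow_eq_map_frob {Fq K : Type*} [Field Fq] [Fintype Fq] [Field K]
    [Algebra Fq K] {m n : ℕ} (k : ℕ) (M : Matrix (Fin m) (Fin n) K) :
    M.map (· ^ Fintype.card Fq ^ k) = M.map (frob Fq K k) := by rw [coe_frob]

namespace TModule

variable {Fq K C : Type*} [Field Fq] [Fintype Fq] [Field K] [Algebra (RatFunc Fq) K] {d : ℕ}
  (E : TModule Fq K d)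

theorem exists_phiCoeff_eq_zero : ∃ D, ∀ k ≥ D, E.phiCoeff k = 0 := by
  choose D hD using fun i => coeff_eq_zero_of_large (Fq := Fq) (f := E.phi i)
  refine ⟨∑ i, D i, fun k hk => ?_⟩
  ext i j
  exact hD i k ((Finset.single_le_sum (fun _ _ => Nat.zero_le _) (Finset.mem_univ i)).trans hk) j

/-- In characteristic $p$ a $q^k$-th power is additive on commuting matrices, so a large enough one
kills the nilpotent part of $d\phi_t$. This reduces all later estimates to a scalar $\theta^Q$. -/
theorem exists_card_pow_eq_smul_one :
    ∃ k : ℕ, E.phiCoeff 0 ^ (Fintype.card Fq ^ k) =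
      theta Fq K ^ (Fintype.card Fq ^ k) • (1 : Matrix (Fin d) (Fin d) K) := by
  obtain ⟨k, hk⟩ := E.nilp
  refine ⟨k, ?_⟩
  obtain ⟨p, f, hp, hq⟩ := exists_pow_eq_iterateFrobenius Fq K
  -- For $d = 0$ the matrix ring is trivial and does not contain $K$, so it cannot inherit the
  -- characteristic of $K$.
  rcases isEmpty_or_nonempty (Fin d) with h | h
  · exact Subsingleton.elim _ _
  have h0 := pow_eq_zero_of_le (Nat.lt_pow_self (Fintype.one_lt_card (α := Fq))).le hk
  have : ExpChar (Matrix (Fin d) (Fin d) K) p := expChar_of_injective_algebraMap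
    (R := K) (FaithfulSMul.algebraMap_injective _ _) p
  rw [E.phiCoeff_zero, ← sub_eq_zero, ← one_pow (M := Matrix (Fin d) (Fin d) K)
    (Fintype.card Fq ^ k), ← _root_.smul_pow, ← h0, hq, ← pow_mul]
  exact (sub_pow_expChar_pow_of_commute p _ ((Commute.one_right _).smul_right _)).symm

variable [Algebra Fq K]

theorem expCoeff_mul_map_frob (P : InftyAbs Fq K) (n : ℕ) :
    E.expCoeff n * (E.phiCoeff 0).map (frob Fq K n) =
      ∑ p ∈ Finset.HasAntidiagonal.antidiagonal n,
        E.phiCoeff p.1 * (E.expCoeff p.2).map (frob Fq K p.1) := by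
  have h := E.expCoeff_spec P n
  simp only [map_pow_eq_map_frob] at h
  rw [h, Finset.Nat.sum_antidiagonal_eq_sum_range_succ_mk, ← Finset.sum_range_reflect]
  refine Finset.sum_congr rfl fun k hk => ?_
  rw [Finset.mem_range] at hk
  rw [show n + 1 - 1 - k = n - k by omega, show n - (n - k) = k by omega]

/-- The functional equation of the exponential for a power of `t`. -/
theorem exists_expCoeff_mul_pow (P : InftyAbs Fq K) (i : ℕ) :
    ∃ ψ : ℕ → Matrix (Fin d) (Fin d) K, (∃ D, ∀ j ≥ D, ψ j = 0) ∧ ψ 0 = E.phiCoeff 0 ^ i ∧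
      ∀ n, E.expCoeff n * (E.phiCoeff 0 ^ i).map (frob Fq K n) =
        ∑ p ∈ Finset.HasAntidiagonal.antidiagonal n, ψ p.1 * (E.expCoeff p.2).map (frob Fq K p.1) := by
  have hff : ∀ (a b : ℕ) (M : Matrix (Fin d) (Fin d) K),
      (M.map (frob Fq K b)).map (frob Fq K a) = M.map (frob Fq K (a + b)) := by
    intro a b M
    ext; simp [frob_frob]
  obtain ⟨D₀, hD₀⟩ := E.exists_phiCoeff_eq_zero
  induction i with
  | zero =>
    refine ⟨fun j => if j = 0 then 1 else 0, ⟨1, fun j hj => if_neg (by omega)⟩, by simp,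
      fun n => ?_⟩
    rw [Finset.sum_eq_single (0, n)]
    · ext; simp [frob_zero_apply]
    · rintro ⟨a, b⟩ hab h
      rw [Finset.HasAntidiagonal.mem_antidiagonal] at hab
      have ha : a ≠ 0 := by rintro rfl; simp_all
      simp [ha]
    · simp
  | succ i ih =>
    obtain ⟨ψ, ⟨D, hD⟩, hψ0, hψ⟩ := ih
    -- Multiplication of twisted polynomials: `ψ` lists the coefficients of $\phi_t^i$ as a
    -- polynomial in $\tau$.
    refine ⟨fun j => ∑ p ∈ Finset.HasAntidiagonal.antidiagonal j, ψ p.1 * (E.phiCoeff p.2).map (frob Fq K p.1),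
      ⟨D + D₀, fun j hj => Finset.sum_eq_zero fun p hp => ?_⟩, ?_, fun n => ?_⟩
    · rw [Finset.HasAntidiagonal.mem_antidiagonal] at hp
      rcases le_or_gt D p.1 with h | h
      · rw [hD _ h, zero_mul]
      · rw [hD₀ p.2 (by omega)]; ext; simp
    · beta_reduce
      rw [Finset.Nat.antidiagonal_zero, Finset.sum_singleton, hψ0, pow_succ]
      congr 1
    · calc _ = (E.expCoeff n * (E.phiCoeff 0 ^ i).map (frob Fq K n)) *
            (E.phiCoeff 0).map (frob Fq K n) := by rw [pow_succ, Matrix.map_mul, mul_assoc]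
        _ = ∑ p ∈ Finset.HasAntidiagonal.antidiagonal n, ∑ s ∈ Finset.HasAntidiagonal.antidiagonal p.2,
            ψ p.1 * (E.phiCoeff s.1).map (frob Fq K p.1) *
              (E.expCoeff s.2).map (frob Fq K (p.1 + s.1)) := by
          rw [hψ, Finset.sum_mul]
          refine Finset.sum_congr rfl fun p hp => ?_
          rw [Finset.HasAntidiagonal.mem_antidiagonal] at hp
          rw [← hp, ← hff, mul_assoc, ← Matrix.map_mul, E.expCoeff_mul_map_frob P,
            ← AlgHom.coe_toRingHom, ← RingHom.mapMatrix_apply, map_sum, Finset.mul_sum]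
          refine Finset.sum_congr rfl fun s _ => ?_
          rw [map_mul, ← mul_assoc, RingHom.mapMatrix_apply, RingHom.mapMatrix_apply,
            AlgHom.coe_toRingHom, hff]
        _ = _ := by
          simp only [Finset.sum_mul]
          rw [Finset.sum_sigma', Finset.sum_sigma']
          exact Finset.sum_nbij' (fun x => ⟨(x.1.1 + x.2.1, x.2.2), (x.1.1, x.2.1)⟩)
            (fun x => ⟨(x.2.1, x.2.2 + x.1.2), (x.2.2, x.1.2)⟩)
            (by rintro ⟨⟨a, b⟩, ⟨e, f⟩⟩; simp; omega) (by rintro ⟨⟨a, b⟩, ⟨e, f⟩⟩; simp; omega)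
            (by rintro ⟨⟨a, b⟩, ⟨e, f⟩⟩; simp +contextual) (by rintro ⟨⟨a, b⟩, ⟨e, f⟩⟩; simp +contextual)
            (by rintro ⟨⟨a, b⟩, ⟨e, f⟩⟩; simp)

end TModule

end Algebraic

/-! ### Entrywise estimates -/

section Estimates

theorem exists_one_le_bound {ι : Type*} [Finite ι] (f : ι → ℝ) : ∃ a, 1 ≤ a ∧ ∀ i, f i ≤ a := by
  obtain ⟨M, hM⟩ := Finite.exists_le f
  exact ⟨max 1 M, le_max_left _ _, fun i => (hM i).trans (le_max_right _ _)⟩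

variable {C : Type*} [NormedField C] [IsUltrametricDist C] {l m n : Type*} [Fintype m]

theorem norm_matrix_mul_le {M : Matrix l m C} {N : Matrix m n C} {a b : ℝ} (ha : 0 ≤ a)
    (hb : 0 ≤ b) (hM : ∀ i j, ‖M i j‖ ≤ a) (hN : ∀ i j, ‖N i j‖ ≤ b) (i : l) (j : n) :
    ‖(M * N) i j‖ ≤ a * b := by
  rw [mul_apply]
  refine IsUltrametricDist.norm_sum_le_of_forall_le_of_nonneg (mul_nonneg ha hb) fun k _ => ?_
  rw [norm_mul]
  exact mul_le_mul (hM i k) (hN k j) (norm_nonneg _) ha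

theorem norm_mulVec_le [Fintype l] {M : Matrix l m C} {a : ℝ} (ha : 0 ≤ a)
    (hM : ∀ i j, ‖M i j‖ ≤ a) (x : m → C) : ‖M *ᵥ x‖ ≤ a * ‖x‖ := by
  refine (pi_norm_le_iff_of_nonneg (mul_nonneg ha (norm_nonneg _))).2 fun i => ?_
  refine IsUltrametricDist.norm_sum_le_of_forall_le_of_nonneg
    (mul_nonneg ha (norm_nonneg _)) fun k _ => ?_
  rw [norm_mul]
  exact mul_le_mul (hM i k) (norm_le_pi_norm x k) (norm_nonneg _) ha

end Estimates

/-! ### Growth of the coefficients of the exponential -/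

namespace TModule

variable {Fq K C : Type*} [Field Fq] [Fintype Fq] [Field K] [Algebra (RatFunc Fq) K] {d : ℕ}
  (E : TModule Fq K d) [Algebra Fq K] [NormedField C] [IsUltrametricDist C] [Algebra K C]

/-- In the functional equation for $t^Q$ with $d\phi_t^Q=\theta^Q$, the coefficient $e_n$ is
multiplied by the scalar $\theta^{Qq^n}-\theta^Q$ of absolute value $q^{Qq^n}$, so no matrix
operator has to be inverted. Here `c` bounds the coefficients of $\phi_t^Q$ and `D` bounds their
number. -/
theorem exists_norm_expCoeff_recursion (P : InftyAbs Fq K)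
    (hθ : ‖algebraMap K C (theta Fq K)‖ = Fintype.card Fq) :
    ∃ (c : ℝ) (D : ℕ), 1 ≤ c ∧ ∀ n ≠ 0, ∀ b : ℝ, 0 ≤ b →
      (∀ l < n, n < l + D → ∀ i j,
        ‖algebraMap K C (E.expCoeff l i j)‖ ^ Fintype.card Fq ^ (n - l) ≤ b) →
      ∀ i j, (Fintype.card Fq : ℝ) ^ Fintype.card Fq ^ n * ‖algebraMap K C (E.expCoeff n i j)‖ ≤
        c * b := by
  obtain ⟨k, hk⟩ := E.exists_card_pow_eq_smul_one
  set q := Fintype.card Fq with hq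
  have hq1 : 1 < q := Fintype.one_lt_card
  have hq1' : (1 : ℝ) < q := by exact_mod_cast hq1
  set Q := q ^ k with hQ
  have hQ0 : 0 < Q := pow_pos (by omega) _
  obtain ⟨ψ, ⟨D, hD⟩, hψ0, hψ⟩ := E.exists_expCoeff_mul_pow P Q
  obtain ⟨c, hc1, hc⟩ := exists_one_le_bound
    fun s : Fin D × Fin d × Fin d => ‖algebraMap K C (ψ s.1 s.2.1 s.2.2)‖
  refine ⟨c, D, hc1, fun n hn b hb h i j => ?_⟩
  have hsum : (theta Fq K ^ (Q * q ^ n) - theta Fq K ^ Q) * E.expCoeff n i j =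
      ∑ p ∈ (Finset.HasAntidiagonal.antidiagonal n).erase (0, n),
        (ψ p.1 * (E.expCoeff p.2).map (frob Fq K p.1)) i j := by
    have h1 := congrFun (congrFun (hψ n) i) j
    rw [hk, Matrix.sum_apply, ← Finset.add_sum_erase _ _ (a := (0, n)) (by simp), hψ0, hk] at h1
    have h2 : (theta Fq K ^ Q • (1 : Matrix (Fin d) (Fin d) K)).map (frob Fq K n) =
        theta Fq K ^ (Q * q ^ n) • (1 : Matrix (Fin d) (Fin d) K) := by
      ext a b
      rcases eq_or_ne a b with rfl | hab
      · simp [frob_apply, pow_mul, hq]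
      · simp [hab]
    rw [h2, mul_smul_comm, mul_one, smul_mul_assoc, one_mul] at h1
    simp only [Matrix.smul_apply, smul_eq_mul, map_apply, frob_zero_apply] at h1
    rw [sub_mul, h1, add_sub_cancel_left]
  have hnorm : ‖algebraMap K C (theta Fq K ^ (Q * q ^ n) - theta Fq K ^ Q)‖ =
      (q : ℝ) ^ (Q * q ^ n) := by
    have hlt : (q : ℝ) ^ Q < (q : ℝ) ^ (Q * q ^ n) := by
      refine pow_lt_pow_right₀ hq1' ?_
      exact lt_mul_of_one_lt_right hQ0 (Nat.one_lt_pow hn hq1)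
    rw [map_sub, map_pow, map_pow, sub_eq_add_neg,
      IsUltrametricDist.norm_add_eq_max_of_norm_ne_norm, norm_neg, norm_pow, norm_pow, hθ,
      max_eq_left hlt.le]
    rw [norm_neg, norm_pow, norm_pow, hθ]
    exact hlt.ne'
  calc (q : ℝ) ^ q ^ n * ‖algebraMap K C (E.expCoeff n i j)‖
      ≤ (q : ℝ) ^ (Q * q ^ n) * ‖algebraMap K C (E.expCoeff n i j)‖ := by
        gcongr
        · exact hq1'.le
        · exact Nat.le_mul_of_pos_left _ hQ0
    _ = ‖algebraMap K C ((theta Fq K ^ (Q * q ^ n) - theta Fq K ^ Q) * E.expCoeff n i j)‖ := by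
        rw [map_mul, norm_mul, hnorm]
    _ ≤ c * b := by
        rw [hsum, map_sum]
        refine IsUltrametricDist.norm_sum_le_of_forall_le_of_nonneg (by positivity) ?_
        rintro ⟨s, l⟩ hp
        rw [Finset.mem_erase, Finset.HasAntidiagonal.mem_antidiagonal] at hp
        obtain ⟨hp1, hp2⟩ := hp
        dsimp only at hp2 ⊢
        rcases le_or_gt D s with hs | hs
        · rw [hD s hs]
          simpa using by positivity
        · have hs0 : s ≠ 0 := by
            rintro rfl
            exact hp1 (by simpa using hp2)
          have hmap : algebraMap K C ((ψ s * (E.expCoeff l).map (frob Fq K s)) i j) =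
              ((ψ s).map (algebraMap K C) *
                ((E.expCoeff l).map (frob Fq K s)).map (algebraMap K C)) i j := by
            rw [← Matrix.map_mul]; rfl
          rw [hmap]
          refine norm_matrix_mul_le (by positivity) hb (fun i j => hc (⟨s, hs⟩, i, j))
            (fun i j => ?_) i j
          rw [map_apply, map_apply, frob_apply, map_pow, norm_pow]
          have := h l (by omega) (by omega) i j
          rwa [show n - l = s by omega] at this

/-- Super-exponential decay of the $e_n$, which makes the exponential converge everywhere. In the
induction the gain $q^{q^n}$ from the recursion must pay for the factor `c` and for replacing
$r^{-l}$ by $r^{-n}$ with $n-l<D$. -/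
theorem exists_expCoeff_bound (P : InftyAbs Fq K)
    (hθ : ‖algebraMap K C (theta Fq K)‖ = Fintype.card Fq) :
    ∃ M r : ℝ, 1 < r ∧ 0 < M ∧ ∀ n i j,
      ‖algebraMap K C (E.expCoeff n i j)‖ ≤ (M / r ^ n) ^ Fintype.card Fq ^ n := by
  obtain ⟨c, D, hc, hrec⟩ := E.exists_norm_expCoeff_recursion P hθ
  set q := Fintype.card Fq with hq
  have hq1 : 1 < q := Fintype.one_lt_card
  have hq1' : (1 : ℝ) < q := by exact_mod_cast hq1
  -- With $r^{D+1}=q$, the factor $r^D$ covers the shift of index and the remaining $r$ covers `c`,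
  -- as $c\le r^{q^n}$ for $n \ge n_0$.
  set r : ℝ := (q : ℝ) ^ ((D + 1 : ℕ) : ℝ)⁻¹ with hr
  have hr1 : 1 < r := Real.one_lt_rpow hq1' (by positivity)
  have hr0 : 0 < r := by positivity
  have hrD : r ^ D * r = q := by
    rw [← pow_succ]; exact Real.rpow_inv_natCast_pow (by positivity) (by omega)
  obtain ⟨n₀, hn₀⟩ := ((tendsto_pow_atTop_atTop_of_one_lt hr1).eventually_ge_atTop c).exists_forall_of_atTop
  obtain ⟨b, hb1, hb⟩ := exists_one_le_bound
    fun s : Fin (n₀ + 1) × Fin d × Fin d => ‖algebraMap K C (E.expCoeff s.1 s.2.1 s.2.2)‖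
  -- This choice of $M$ makes $M/r^n\ge b\ge1$ for all $n\le n_0$, which settles the initial cases.
  refine ⟨b * r ^ n₀, r, hr1, by positivity, fun n => ?_⟩
  induction n using Nat.strong_induction_on with
  | _ n ih =>
  intro i j
  rcases le_or_gt n n₀ with hn | hn
  · calc _ ≤ b := hb (⟨n, by omega⟩, i, j)
      _ ≤ b * r ^ n₀ / r ^ n := by
        rw [mul_div_assoc]
        exact le_mul_of_one_le_right (by positivity)
          ((one_le_div (by positivity)).2 (pow_le_pow_right₀ hr1.le hn))
      _ ≤ _ := by
        refine le_self_pow₀ ?_ (pow_ne_zero _ (by omega))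
        rw [mul_div_assoc]
        exact one_le_mul_of_one_le_of_one_le hb1
          ((one_le_div (by positivity)).2 (pow_le_pow_right₀ hr1.le hn))
  · set M := b * r ^ n₀ with hM
    have hM0 : 0 < M := by positivity
    have key := hrec n (by omega) ((M / r ^ n) ^ q ^ n * (r ^ D) ^ q ^ n) (by positivity)
      (fun l hl hlD i j => ?_) i j
    · have hcr : c ≤ r ^ q ^ n :=
        (hn₀ n hn.le).trans (pow_le_pow_right₀ hr1.le (Nat.lt_pow_self hq1).le)
      refine le_of_mul_le_mul_left (key.trans ?_) (show (0 : ℝ) < (q : ℝ) ^ q ^ n by positivity)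
      calc _ ≤ r ^ q ^ n * ((M / r ^ n) ^ q ^ n * (r ^ D) ^ q ^ n) := by gcongr
        _ = _ := by rw [← hrD, mul_pow]; ring
    · calc _ ≤ ((M / r ^ l) ^ q ^ l) ^ q ^ (n - l) := by
            gcongr
            exact ih l hl i j
        _ = (M / r ^ l) ^ q ^ n := by
            rw [← pow_mul, ← pow_add, Nat.add_sub_cancel' hl.le]
        _ ≤ (M / r ^ n * r ^ D) ^ q ^ n := by
            gcongr
            rw [div_mul_eq_mul_div, div_le_div_iff₀ (by positivity) (by positivity),
              mul_assoc M, ← pow_add]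
            exact mul_le_mul_of_nonneg_left
              (pow_le_pow_right₀ hr1.le (show n ≤ D + l by omega)) hM0.le
        _ = _ := mul_pow _ _ _

theorem exists_forall_norm_expCoeff_le (P : InftyAbs Fq K)
    (hθ : ‖algebraMap K C (theta Fq K)‖ = Fintype.card Fq) :
    ∃ c : ℝ, 1 ≤ c ∧ ∀ n i j, ‖algebraMap K C (E.expCoeff n i j)‖ ≤ c := by
  obtain ⟨M, r, hr, hM, h⟩ := E.exists_expCoeff_bound P hθ
  obtain ⟨n₀, hn₀⟩ :=
    ((tendsto_pow_atTop_atTop_of_one_lt hr).eventually_ge_atTop M).exists_forall_of_atTop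
  obtain ⟨b, hb1, hb⟩ := exists_one_le_bound
    fun s : Fin n₀ × Fin d × Fin d => ‖algebraMap K C (E.expCoeff s.1 s.2.1 s.2.2)‖
  refine ⟨b, hb1, fun n i j => ?_⟩
  rcases lt_or_ge n n₀ with hn | hn
  · exact hb (⟨n, hn⟩, i, j)
  · refine (h n i j).trans ((pow_le_one₀ (by positivity) ?_).trans hb1)
    exact (div_le_one (by positivity)).2 (hn₀ n hn)

end TModule

/-! ### The exponential function -/

namespace TModule

variable {Fq K : Type*} (C : Type*) [Field Fq] [Fintype Fq] [Field K] [Algebra (RatFunc Fq) K]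
  {d : ℕ} (E : TModule Fq K d) [NormedField C] [Algebra K C] [Algebra Fq C]

/-- The map `φ_t` on `C`-valued points. -/
def phiMap : (Fin d → C) →ₗ[Fq] (Fin d → C) := LinearMap.pi fun i => evalGa (E.phi_mem i)

/-- The coefficient of `τ ^ k` in `φ_t` as a map on `C`-valued points. -/
def phiTerm (k : ℕ) : (Fin d → C) →ₗ[Fq] (Fin d → C) :=
  ((E.phiCoeff k).map (algebraMap K C)).mulVecLin.restrictScalars Fq ∘ₗ frobVec Fq k

/-- The `n`-th term of the exponential series. -/
def expTerm (n : ℕ) : (Fin d → C) →ₗ[Fq] (Fin d → C) :=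
  ((E.expCoeff n).map (algebraMap K C)).mulVecLin.restrictScalars Fq ∘ₗ frobVec Fq n

variable {C}

theorem phiMap_apply (x : Fin d → C) (i : Fin d) :
    E.phiMap C x i = MvPolynomial.aeval x (E.phi i) := rfl

theorem phiTerm_apply (k : ℕ) (x : Fin d → C) : E.phiTerm C k x =
    (E.phiCoeff k).map (algebraMap K C) *ᵥ frobVec Fq k x := rfl

theorem expTerm_apply (n : ℕ) (x : Fin d → C) : E.expTerm C n x =
    (E.expCoeff n).map (algebraMap K C) *ᵥ frobVec Fq n x := rfl

theorem expTerm_zero (x : Fin d → C) : E.expTerm C 0 x = x := by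
  rw [expTerm_apply, expCoeff, Matrix.map_one _ (map_zero _) (map_one _), one_mulVec]
  ext i
  simp

theorem exists_phiMap_eq_sum : ∃ D, (∀ k ≥ D, E.phiTerm C k = 0) ∧
    ∀ x, E.phiMap C x = ∑ k ∈ Finset.range D, E.phiTerm C k x := by
  choose D hD using fun i => exists_aeval_expansion (C := C) (E.phi_mem i)
  obtain ⟨D₀, hD₀⟩ := E.exists_phiCoeff_eq_zero
  refine ⟨D₀ + ∑ i, D i, fun k hk => ?_, fun x => ?_⟩
  · ext x
    rw [LinearMap.comp_apply, phiTerm_apply, hD₀ k (by omega)]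
    simp [Matrix.map_zero]
  · ext i
    rw [phiMap_apply, hD i _ ((Finset.single_le_sum (f := D) (fun _ _ => Nat.zero_le _)
      (Finset.mem_univ i)).trans (Nat.le_add_left _ _)), Finset.sum_apply]
    refine Finset.sum_congr rfl fun k _ => ?_
    simp [phiTerm_apply, mulVec, dotProduct, phiCoeff]

theorem continuous_phiTerm (k : ℕ) : Continuous (E.phiTerm C k) := by
  refine Continuous.matrix_mulVec (A := fun _ => (E.phiCoeff k).map (algebraMap K C))
    (B := frobVec Fq k) continuous_const (continuous_pi fun i => ?_)
  simp only [frobVec_apply]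
  fun_prop

variable (C) in
/-- The matrix of `dφ_t` over `C`. -/
def lieMat : Matrix (Fin d) (Fin d) C := (differential E.phi).map (algebraMap K C)

theorem expTerm_lieMat_mulVec (P : InftyAbs Fq K) [Algebra Fq K] (n : ℕ) (x : Fin d → C) :
    E.expTerm C n (E.lieMat C *ᵥ x) =
      ∑ p ∈ Finset.HasAntidiagonal.antidiagonal n, E.phiTerm C p.1 (E.expTerm C p.2 x) := by
  have hmap : ∀ (n : ℕ) (M : Matrix (Fin d) (Fin d) K),
      (M.map (algebraMap K C)).map (frob Fq C n) = (M.map (frob Fq K n)).map (algebraMap K C) := by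
    intro n M
    ext; simp [frob_apply]
  have h := congrArg (fun M => M.map (algebraMap K C)) (E.expCoeff_mul_map_frob P n)
  beta_reduce at h
  rw [← RingHom.mapMatrix_apply (algebraMap K C) (∑ p ∈ _, _), map_sum, Matrix.map_mul,
    ← hmap] at h
  rw [expTerm_apply, lieMat, ← E.phiCoeff_zero, frobVec_mulVec, mulVec_mulVec, h, sum_mulVec]
  refine Finset.sum_congr rfl fun p hp => ?_
  rw [Finset.HasAntidiagonal.mem_antidiagonal] at hp
  rw [phiTerm_apply, expTerm_apply, frobVec_mulVec, frobVec_frobVec, mulVec_mulVec, hmap, hp,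
    RingHom.mapMatrix_apply, Matrix.map_mul]

theorem exp_eq_tsum (x : Fin d → C) : E.exp C x = ∑' n, E.expTerm C n x := by
  simp only [expTerm_apply]
  refine tsum_congr fun n => congrArg _ ?_
  ext i
  simp

theorem norm_frobVec_le (n : ℕ) (x : Fin d → C) :
    ‖frobVec Fq n x‖ ≤ ‖x‖ ^ Fintype.card Fq ^ n := by
  refine (pi_norm_le_iff_of_nonneg (by positivity)).2 fun i => ?_
  rw [frobVec_apply, norm_pow]
  exact pow_le_pow_left₀ (norm_nonneg _) (norm_le_pi_norm x i) _

variable [IsUltrametricDist C] [Algebra Fq K]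

variable [CompleteSpace C]

theorem summable_expTerm (P : InftyAbs Fq K)
    (hθ : ‖algebraMap K C (theta Fq K)‖ = Fintype.card Fq) (x : Fin d → C) :
    Summable fun n => E.expTerm C n x := by
  obtain ⟨M, r, hr, hM, h⟩ := E.exists_expCoeff_bound P hθ
  have ht : Tendsto (fun n : ℕ => M * ‖x‖ / r ^ n) atTop (𝓝 0) :=
    (tendsto_pow_atTop_atTop_of_one_lt hr).const_div_atTop _
  refine Summable.of_norm_bounded_eventually_nat
    (summable_geometric_of_lt_one (r := 1 / 2) (by norm_num) (by norm_num)) ?_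
  filter_upwards [ht.eventually_le_const (show (0 : ℝ) < 1 / 2 by norm_num)] with n hn
  have hn0 : n ≤ Fintype.card Fq ^ n := (Nat.lt_pow_self Fintype.one_lt_card).le
  calc ‖E.expTerm C n x‖ ≤ (M / r ^ n) ^ Fintype.card Fq ^ n * ‖frobVec Fq n x‖ :=
        norm_mulVec_le (by positivity) (fun i j => h n i j) _
    _ ≤ (M / r ^ n) ^ Fintype.card Fq ^ n * ‖x‖ ^ Fintype.card Fq ^ n := by
        gcongr
        exact norm_frobVec_le n x
    _ = (M * ‖x‖ / r ^ n) ^ Fintype.card Fq ^ n := by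
        rw [← mul_pow, div_mul_eq_mul_div]
    _ ≤ (1 / 2) ^ Fintype.card Fq ^ n := pow_le_pow_left₀ (by positivity) hn _
    _ ≤ (1 / 2) ^ n := pow_le_pow_of_le_one (by norm_num) (by norm_num) hn0

theorem hasSum_exp (P : InftyAbs Fq K)
    (hθ : ‖algebraMap K C (theta Fq K)‖ = Fintype.card Fq) (x : Fin d → C) :
    HasSum (fun n => E.expTerm C n x) (E.exp C x) :=
  E.exp_eq_tsum x ▸ (E.summable_expTerm P hθ x).hasSum

/-- The exponential as an `𝔽_q`-linear map. -/
def expLin (P : InftyAbs Fq K) (hθ : ‖algebraMap K C (theta Fq K)‖ = Fintype.card Fq) :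
    (Fin d → C) →ₗ[Fq] (Fin d → C) where
  toFun := E.exp C
  map_add' x y := by
    refine (E.hasSum_exp P hθ (x + y)).unique ?_
    simpa only [map_add] using (E.hasSum_exp P hθ x).add (E.hasSum_exp P hθ y)
  map_smul' c x := by
    refine (E.hasSum_exp P hθ (c • x)).unique ?_
    simpa only [map_smul, algebraMap_smul, RingHom.id_apply] using
      (E.hasSum_exp P hθ x).const_smul (algebraMap Fq C c)

theorem expLin_apply (P : InftyAbs Fq K)
    (hθ : ‖algebraMap K C (theta Fq K)‖ = Fintype.card Fq) (x : Fin d → C) :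
    E.expLin P hθ x = E.exp C x := rfl

/-- $\phi_t$ is a finite sum of continuous terms, so it can be applied to the series termwise;
collecting by total degree in $\tau$ gives the coefficient identity. -/
theorem exp_lieMat_mulVec (P : InftyAbs Fq K)
    (hθ : ‖algebraMap K C (theta Fq K)‖ = Fintype.card Fq) (x : Fin d → C) :
    E.exp C (E.lieMat C *ᵥ x) = E.phiMap C (E.exp C x) := by
  obtain ⟨D, hD, hphi⟩ := E.exists_phiMap_eq_sum (C := C)
  rw [hphi]
  refine (E.hasSum_exp P hθ _).unique ?_
  -- The series for the $k$-th term of $\phi_t$ is shifted by $k$ and padded with zeros, so that all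
  -- of them are indexed by total degree.
  have h : ∀ k, HasSum (fun n => if k ≤ n then E.phiTerm C k (E.expTerm C (n - k) x) else 0)
      (E.phiTerm C k (E.exp C x)) := by
    intro k
    rw [← (add_left_injective k).hasSum_iff]
    · simpa [Function.comp_def] using
        (E.hasSum_exp P hθ x).map (E.phiTerm C k) (E.continuous_phiTerm k)
    · intro n hn
      rw [if_neg]
      exact fun hkn => hn ⟨n - k, Nat.sub_add_cancel hkn⟩
  convert! hasSum_sum (s := Finset.range D) fun k _ => h k using 2 with n
  rw [E.expTerm_lieMat_mulVec P, Finset.Nat.sum_antidiagonal_eq_sum_range_succ_mk,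
    ← Finset.sum_filter]
  symm
  refine Finset.sum_subset_zero_on_sdiff (fun k hk => ?_) (fun k hk => ?_) fun _ _ => rfl
  · simp only [Finset.mem_filter, Finset.mem_range] at hk ⊢
    omega
  · simp only [Finset.mem_filter, Finset.mem_range, Finset.mem_sdiff] at hk
    rw [hD k (by by_contra!; exact hk.2 ⟨this, by omega⟩), LinearMap.zero_apply]

/-- Since $e_0=1$, the difference contains only powers $\tau^n$ with $n\ge1$, with uniformly bounded
coefficients. -/
theorem exists_norm_exp_sub_le (P : InftyAbs Fq K)
    (hθ : ‖algebraMap K C (theta Fq K)‖ = Fintype.card Fq) :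
    ∃ c : ℝ, 1 ≤ c ∧ ∀ x : Fin d → C, ‖x‖ ≤ 1 →
      ‖E.exp C x - x‖ ≤ c * ‖x‖ ^ Fintype.card Fq := by
  obtain ⟨c, hc1, hc⟩ := E.exists_forall_norm_expCoeff_le P hθ
  refine ⟨c, hc1, fun x hx => ?_⟩
  have h := (hasSum_nat_add_iff' 1).2 (E.hasSum_exp P hθ x)
  rw [Finset.sum_range_one, expTerm_zero] at h
  rw [← h.tsum_eq]
  refine IsUltrametricDist.norm_tsum_le_of_forall_le_of_nonneg (by positivity) fun n => ?_
  refine (norm_mulVec_le (by positivity) (fun i j => hc _ i j) _).trans ?_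
  gcongr
  refine (norm_frobVec_le _ x).trans (pow_le_pow_of_le_one (norm_nonneg _) hx ?_)
  exact Nat.le_self_pow (Nat.succ_ne_zero n) _

end TModule

/-! ### Periods and convergent systems of torsion points -/

/-- Inversion of a contractive additive perturbation of the identity near the origin. -/
theorem exists_add_apply_eq {V : Type*} [NormedAddCommGroup V] [CompleteSpace V] (g : V →+ V)
    {ε : ℝ} (hε : 0 < ε) (hg : ∀ x, ‖x‖ ≤ ε → ‖g x‖ ≤ ‖x‖ / 2) (y : V) (hy : ‖y‖ ≤ ε) :
    ∃ x, ‖x‖ ≤ 2 * ‖y‖ ∧ x + g x = y := by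
  have hcont : Continuous g := by
    refine continuous_of_continuousAt_zero g ?_
    rw [ContinuousAt, map_zero]
    refine squeeze_zero_norm' (a := fun x => ‖x‖ / 2) ?_ ?_
    · filter_upwards [Metric.closedBall_mem_nhds (0 : V) hε] with x hx
      exact hg x (by simpa using hx)
    · simpa using (continuous_norm.tendsto (0 : V)).div_const 2
  -- The solution is the Neumann series $\sum_n (-g)^n y$; its terms stay in the ball where $g$
  -- halves norms.
  set u : ℕ → V := fun n => (-g)^[n] y with hu
  have hus : ∀ n, u (n + 1) = (-g) (u n) := fun n => Function.iterate_succ_apply' _ _ _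
  have hun : ∀ n, ‖u n‖ ≤ ‖y‖ * (1 / 2) ^ n := by
    intro n
    induction n with
    | zero => simp [hu]
    | succ n ih =>
      have h1 : ‖u n‖ ≤ ε :=
        ih.trans ((mul_le_of_le_one_right (norm_nonneg _)
          (pow_le_one₀ (by norm_num) (by norm_num))).trans hy)
      rw [hus, AddMonoidHom.neg_apply, norm_neg, pow_succ]
      linarith [hg _ h1]
  have hgeo := hasSum_geometric_two.mul_left ‖y‖
  have hsum : Summable u := Summable.of_norm_bounded hgeo.summable hun
  refine ⟨∑' n, u n, (tsum_of_norm_bounded hgeo hun).trans_eq (mul_comm _ _), ?_⟩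
  have h1 := (hasSum_nat_add_iff' 1).2 hsum.hasSum
  have h2 := hsum.hasSum.map (-g) (show Continuous fun v => -g v from hcont.neg)
  have h3 := h1.unique (by simpa only [hus] using! h2)
  rw [Finset.sum_range_one, AddMonoidHom.neg_apply, show u 0 = y from rfl] at h3
  rw [← neg_neg (g _), ← h3]
  abel

namespace TModule

/-! ### Negative powers of $d\phi_t$ -/

section LieMat

variable {Fq K C : Type*} [Field Fq] [Fintype Fq] [Field K] [Algebra (RatFunc Fq) K]
  {d : ℕ} (E : TModule Fq K d) [NormedField C] [Algebra K C]

theorem exists_lieMat_pow : ∃ k : ℕ, E.lieMat C ^ (Fintype.card Fq ^ k) =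
    algebraMap K C (theta Fq K) ^ (Fintype.card Fq ^ k) • (1 : Matrix (Fin d) (Fin d) C) := by
  obtain ⟨k, hk⟩ := E.exists_card_pow_eq_smul_one
  refine ⟨k, ?_⟩
  have h := congrArg (algebraMap K C).mapMatrix hk
  rw [map_pow, E.phiCoeff_zero] at h
  refine h.trans ?_
  ext i j
  rcases eq_or_ne i j with rfl | hij
  · simp
  · simp [hij]

variable (hθ : ‖algebraMap K C (theta Fq K)‖ = Fintype.card Fq)

include hθ

theorem algebraMap_theta_ne_zero : algebraMap K C (theta Fq K) ≠ 0 := by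
  rw [← norm_ne_zero_iff, hθ]
  exact_mod_cast Fintype.card_ne_zero

theorem isUnit_det_lieMat : IsUnit (E.lieMat C).det := by
  obtain ⟨k, hk⟩ := E.exists_lieMat_pow (C := C)
  have h := congrArg Matrix.det hk
  rw [det_pow, det_smul, det_one, mul_one] at h
  refine isUnit_iff_ne_zero.2 fun h0 => ?_
  rw [h0, zero_pow (pow_ne_zero _ Fintype.card_ne_zero)] at h
  exact pow_ne_zero _ (pow_ne_zero _ (algebraMap_theta_ne_zero hθ)) h.symm

theorem lieMat_mulVec_inv_pow_succ (n : ℕ) (x : Fin d → C) :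
    E.lieMat C *ᵥ ((E.lieMat C)⁻¹ ^ (n + 1) *ᵥ x) = (E.lieMat C)⁻¹ ^ n *ᵥ x := by
  rw [mulVec_mulVec, pow_succ', ← mul_assoc, mul_nonsing_inv _ (E.isUnit_det_lieMat hθ), one_mul]

theorem inv_pow_mulVec_pow (n : ℕ) (x : Fin d → C) :
    (E.lieMat C)⁻¹ ^ n *ᵥ (E.lieMat C ^ n *ᵥ x) = x := by
  rw [mulVec_mulVec, inv_pow', nonsing_inv_mul, one_mulVec]
  rw [det_pow]
  exact (E.isUnit_det_lieMat hθ).pow n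

theorem pow_mulVec_inv_pow (n : ℕ) (x : Fin d → C) :
    E.lieMat C ^ n *ᵥ ((E.lieMat C)⁻¹ ^ n *ᵥ x) = x := by
  rw [mulVec_mulVec, inv_pow', mul_nonsing_inv, one_mulVec]
  rw [det_pow]
  exact (E.isUnit_det_lieMat hθ).pow n

/-- The $Q$-th power of $d\phi_t^{-1}$ is the scalar $\theta^{-Q}$. Division of the exponent by $Q$
leaves finitely many remainders, and these determine `c`. -/
theorem exists_norm_inv_pow_mulVec_le [IsUltrametricDist C] :
    ∃ c : ℝ, 1 ≤ c ∧ ∀ n (x : Fin d → C),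
      ‖(E.lieMat C)⁻¹ ^ n *ᵥ x‖ ≤ c * (Fintype.card Fq : ℝ)⁻¹ ^ n * ‖x‖ := by
  obtain ⟨k, hk⟩ := E.exists_lieMat_pow (C := C)
  have hq0 : (0 : ℝ) < Fintype.card Fq := by exact_mod_cast Fintype.card_pos
  set q := Fintype.card Fq
  set Q := q ^ k
  have hQ0 : 0 < Q := pow_pos Fintype.card_pos _
  have hinv : (E.lieMat C)⁻¹ ^ Q = (algebraMap K C (theta Fq K))⁻¹ ^ Q • 1 := by
    rw [inv_pow']
    refine inv_eq_right_inv ?_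
    rw [hk, smul_mul_smul_comm, one_mul, ← mul_pow,
      mul_inv_cancel₀ (algebraMap_theta_ne_zero hθ), one_pow, one_smul]
  obtain ⟨c, hc1, hc⟩ := exists_one_le_bound
    fun s : Fin Q × Fin d × Fin d =>
      ‖((E.lieMat C)⁻¹ ^ (s.1 : ℕ)) s.2.1 s.2.2‖ * (q : ℝ) ^ (s.1 : ℕ)
  refine ⟨c, hc1, fun n x => norm_mulVec_le (by positivity) (fun i j => ?_) x⟩
  have hs : n % Q < Q := Nat.mod_lt _ hQ0
  have h1 : ‖((E.lieMat C)⁻¹ ^ (n % Q)) i j‖ ≤ c * (q : ℝ)⁻¹ ^ (n % Q) := by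
    rw [inv_pow, ← div_eq_mul_inv, le_div_iff₀ (by positivity)]
    exact hc (⟨n % Q, hs⟩, i, j)
  calc _ = ‖((E.lieMat C)⁻¹ ^ (Q * (n / Q) + n % Q)) i j‖ := by rw [Nat.div_add_mod]
    _ = (q : ℝ)⁻¹ ^ (Q * (n / Q)) * ‖((E.lieMat C)⁻¹ ^ (n % Q)) i j‖ := by
      rw [pow_add, pow_mul, hinv, _root_.smul_pow, one_pow, smul_mul_assoc, one_mul,
        Matrix.smul_apply, norm_smul, ← pow_mul, norm_pow, norm_inv, hθ]
    _ ≤ (q : ℝ)⁻¹ ^ (Q * (n / Q)) * (c * (q : ℝ)⁻¹ ^ (n % Q)) := by gcongr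
    _ = c * (q : ℝ)⁻¹ ^ n := by
      conv_rhs => rw [← Nat.div_add_mod n Q, pow_add]
      ring

theorem tendsto_inv_pow_mulVec [IsUltrametricDist C] (x : Fin d → C) :
    Tendsto (fun n => (E.lieMat C)⁻¹ ^ n *ᵥ x) atTop (𝓝 0) := by
  obtain ⟨c, -, hc⟩ := E.exists_norm_inv_pow_mulVec_le hθ
  refine squeeze_zero_norm (fun n => hc n x) ?_
  have hq : (1 : ℝ) < Fintype.card Fq := by exact_mod_cast Fintype.one_lt_card
  have := ((tendsto_pow_atTop_nhds_zero_of_lt_one (by positivity)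
    (inv_lt_one_of_one_lt₀ hq)).const_mul c).mul_const ‖x‖
  simpa using this

end LieMat

/-! ### The exponential near the origin and torsion systems -/

section Period

variable {Fq K C : Type*} [Field Fq] [Fintype Fq] [Field K] [Algebra (RatFunc Fq) K]
  {d : ℕ} (E : TModule Fq K d) [NormedField C] [Algebra K C] [Algebra Fq C]
  [IsUltrametricDist C] [Algebra Fq K] [CompleteSpace C] (P : InftyAbs Fq K)
  (hθ : ‖algebraMap K C (theta Fq K)‖ = Fintype.card Fq)

include P hθ

/-- On the ball of radius $1/(2c)$ the error $c\|x\|^q\le c\|x\|^2$ is at most $\|x\|/2$, so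
$\exp_E$ is a contractive additive perturbation of the identity. -/
theorem exists_exp_local_inverse : ∃ ε : ℝ, 0 < ε ∧ ε ≤ 1 ∧
    (∀ x : Fin d → C, ‖x‖ ≤ ε → ‖E.exp C x - x‖ ≤ ‖x‖ / 2) ∧
    (∀ x : Fin d → C, ‖x‖ ≤ ε → E.exp C x = 0 → x = 0) ∧
    ∀ y : Fin d → C, ‖y‖ ≤ ε → ∃ x, ‖x‖ ≤ 2 * ‖y‖ ∧ E.exp C x = y := by
  obtain ⟨c, hc1, hc⟩ := E.exists_norm_exp_sub_le P hθ
  have hc0 : 0 < c := by positivity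
  have hε1 : 1 / (2 * c) ≤ 1 := (div_le_one (by positivity)).2 (by linarith)
  have hsmall : ∀ x : Fin d → C, ‖x‖ ≤ 1 / (2 * c) → ‖E.exp C x - x‖ ≤ ‖x‖ / 2 := by
    intro x hx
    have h2 : 2 ≤ Fintype.card Fq := Fintype.one_lt_card
    calc _ ≤ c * ‖x‖ ^ Fintype.card Fq := hc x (hx.trans hε1)
      _ ≤ c * ‖x‖ ^ 2 := by
        have := pow_le_pow_of_le_one (norm_nonneg x) (hx.trans hε1) h2
        gcongr
      _ ≤ c * (1 / (2 * c) * ‖x‖) := by rw [pow_two]; gcongr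
      _ = ‖x‖ / 2 := by field_simp
  refine ⟨1 / (2 * c), by positivity, hε1, hsmall, fun x hx h0 => ?_, fun y hy => ?_⟩
  · have h := hsmall x hx
    rw [h0, zero_sub, norm_neg] at h
    exact norm_le_zero_iff.1 (by linarith [norm_nonneg x])
  · obtain ⟨x, hx, hxy⟩ := exists_add_apply_eq
      ((E.expLin P hθ).toAddMonoidHom - AddMonoidHom.id (Fin d → C)) (by positivity) hsmall y hy
    refine ⟨x, hx, ?_⟩
    rw [← hxy]
    exact (add_sub_cancel x (E.exp C x)).symm

theorem tendsto_exp_of_tendsto {x : ℕ → Fin d → C} (hx : Tendsto x atTop (𝓝 0)) :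
    Tendsto (fun n => E.exp C (x n)) atTop (𝓝 0) := by
  obtain ⟨ε, hε, -, hsmall, -⟩ := E.exists_exp_local_inverse P hθ
  have h1 : Tendsto (fun n => E.exp C (x n) - x n) atTop (𝓝 0) := by
    refine squeeze_zero_norm' (a := fun n => ‖x n‖ / 2) ?_ ?_
    · filter_upwards [hx.norm.eventually_le_const (by simpa using hε)] with n hn
      exact hsmall _ hn
    · simpa using hx.norm.div_const 2
  simpa using h1.add hx

/-- Every system of `t`-power torsion points tending to `0` comes from a period. -/
theorem exists_period_of_torsion {h : ℕ → Fin d → C} (h0 : Tendsto h atTop (𝓝 0))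
    (hphi0 : E.phiMap C (h 0) = 0) (hphi : ∀ n, E.phiMap C (h (n + 1)) = h n) :
    ∃ l : Fin d → C, E.exp C l = 0 ∧
      ∀ n, h n = E.exp C ((E.lieMat C)⁻¹ ^ (n + 1) *ᵥ l) := by
  obtain ⟨ε, hε, -, -, hinj, hsurj⟩ := E.exists_exp_local_inverse P hθ
  obtain ⟨a, ha1, ha⟩ := exists_one_le_bound fun s : Fin d × Fin d => ‖E.lieMat C s.1 s.2‖
  have ha0 : 0 < a := by positivity
  -- If $\|h_n\|\le\varepsilon/(4a)$, the small logarithms satisfy $\|x_n\|\le\varepsilon/(2a)$, so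
  -- both $d\phi_t\,x_{n+1}$ and $x_n$ have norm at most $\varepsilon/2$ and their difference lies
  -- in the ball of injectivity.
  have hδ : 0 < ε / (4 * a) := by positivity
  have hδε : ε / (4 * a) ≤ ε / 4 := by
    gcongr
    linarith
  obtain ⟨N, hN⟩ := (h0.norm.eventually_le_const (by simpa using hδ)).exists_forall_of_atTop
  have hx : ∀ n, ∃ x : Fin d → C, N ≤ n → ‖x‖ ≤ ε / (2 * a) ∧ E.exp C x = h n := by
    intro n
    rcases le_or_gt N n with hn | hn
    · obtain ⟨x, hx1, hx2⟩ := hsurj (h n) (by linarith [hN n hn])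
      refine ⟨x, fun _ => ⟨hx1.trans ?_, hx2⟩⟩
      calc _ ≤ 2 * (ε / (4 * a)) := by linarith [hN n hn]
        _ = _ := by field_simp; norm_num
    · exact ⟨0, fun h => absurd h (by omega)⟩
  choose x hx using hx
  have hstep : ∀ n ≥ N, E.lieMat C *ᵥ x (n + 1) = x n := by
    intro n hn
    have h1 := hx n hn
    have h2 := hx (n + 1) (by omega)
    rw [← sub_eq_zero]
    refine hinj _ ?_ ?_
    · refine (norm_sub_le _ _).trans ?_
      have h3 := norm_mulVec_le ha0.le (fun i j => ha (i, j)) (x (n + 1))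
      have h4 : a * ‖x (n + 1)‖ ≤ a * (ε / (2 * a)) := by gcongr; exact h2.1
      have h5 : a * (ε / (2 * a)) = ε / 2 := by field_simp
      have h6 : ε / (2 * a) ≤ ε / 2 := by gcongr; linarith
      linarith [h1.1]
    · rw [← E.expLin_apply P hθ, map_sub, E.expLin_apply, E.expLin_apply,
        E.exp_lieMat_mulVec P hθ, h2.2, hphi, h1.2, sub_self]
  have hx' : ∀ k, x (N + k) =
      (E.lieMat C)⁻¹ ^ (N + k + 1) *ᵥ (E.lieMat C ^ (N + 1) *ᵥ x N) := by
    intro k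
    induction k with
    | zero => exact (E.inv_pow_mulVec_pow hθ (N + 1) (x N)).symm
    | succ k ih =>
      have h1 := hstep (N + k) (by omega)
      rw [ih, ← E.lieMat_mulVec_inv_pow_succ hθ] at h1
      have hcancel : ∀ v, (E.lieMat C)⁻¹ *ᵥ (E.lieMat C *ᵥ v) = v := fun v => by
        simpa only [pow_one] using E.inv_pow_mulVec_pow hθ 1 v
      have h2 := congrArg (fun v => (E.lieMat C)⁻¹ *ᵥ v) h1
      beta_reduce at h2
      rw [hcancel, hcancel] at h2
      exact h2
  -- The relations $d\phi_t\,x_{n+1}=x_n$ make $d\phi_t^{n+1}x_n$ independent of $n\ge N$; this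
  -- common value is the period. For $n<N$ the formula descends by applying $\phi_t$.
  set l := E.lieMat C ^ (N + 1) *ᵥ x N
  have hl : ∀ n, h n = E.exp C ((E.lieMat C)⁻¹ ^ (n + 1) *ᵥ l) := by
    intro n
    rcases le_or_gt N n with hn | hn
    · obtain ⟨k, rfl⟩ := Nat.exists_eq_add_of_le hn
      rw [← hx', (hx (N + k) hn).2]
    · refine Nat.decreasingInduction
        (motive := fun n _ => h n = E.exp C ((E.lieMat C)⁻¹ ^ (n + 1) *ᵥ l))
        (fun n _ ih => ?_) ?_ hn.le
      · rw [← E.lieMat_mulVec_inv_pow_succ hθ, E.exp_lieMat_mulVec P hθ, ← ih, hphi]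
      · exact (hx N le_rfl).2 ▸ congrArg _ (hx' 0)
  refine ⟨l, ?_, hl⟩
  have h1 := E.lieMat_mulVec_inv_pow_succ hθ 0 l
  rw [pow_zero, one_mulVec] at h1
  rw [← h1, E.exp_lieMat_mulVec P hθ, ← hl 0, hphi0]

theorem phiMap_torsion_zero {l : Fin d → C} (hl : E.exp C l = 0) :
    E.phiMap C (E.exp C ((E.lieMat C)⁻¹ ^ (0 + 1) *ᵥ l)) = 0 := by
  rw [← E.exp_lieMat_mulVec P hθ, E.lieMat_mulVec_inv_pow_succ hθ, pow_zero, one_mulVec, hl]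

theorem phiMap_torsion_succ (l : Fin d → C) (n : ℕ) :
    E.phiMap C (E.exp C ((E.lieMat C)⁻¹ ^ (n + 1 + 1) *ᵥ l)) =
      E.exp C ((E.lieMat C)⁻¹ ^ (n + 1) *ᵥ l) := by
  rw [← E.exp_lieMat_mulVec P hθ, E.lieMat_mulVec_inv_pow_succ hθ]

theorem tendsto_torsion (l : Fin d → C) :
    Tendsto (fun n => E.exp C ((E.lieMat C)⁻¹ ^ (n + 1) *ᵥ l)) atTop (𝓝 0) :=
  E.tendsto_exp_of_tendsto P hθ
    ((E.tendsto_inv_pow_mulVec hθ l).comp (tendsto_add_atTop_nat 1))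

/-- For large $n$ the vector $d\phi_t^{-n-1}l$ lies in the ball where $\exp_E$ is injective. -/
theorem eq_zero_of_torsion_eq_zero {l : Fin d → C}
    (h : ∀ n, E.exp C ((E.lieMat C)⁻¹ ^ (n + 1) *ᵥ l) = 0) : l = 0 := by
  obtain ⟨ε, hε, -, -, hinj, -⟩ := E.exists_exp_local_inverse P hθ
  have ht := (E.tendsto_inv_pow_mulVec hθ l).comp (tendsto_add_atTop_nat 1)
  obtain ⟨n, hn⟩ := (ht.norm.eventually_le_const (by simpa using hε)).exists
  have h1 := hinj _ hn (h n)
  rw [← E.pow_mulVec_inv_pow hθ (n + 1) l]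
  exact (congrArg _ h1).trans (mulVec_zero _)

end Period

end TModule

/-! ### The pairing of the motive with sequences of points -/

section Series

/-- The embedding `R[t] → C⟦t⟧`. -/
def polyToSeries (R C : Type*) [CommSemiring R] [CommSemiring C] [Algebra R C] : R[X] →+* C⟦X⟧ :=
  (Polynomial.coeToPowerSeries.ringHom (R := C)).comp (Polynomial.mapRingHom (algebraMap R C))

section

variable {R C : Type*} [CommSemiring R] [CommSemiring C] [Algebra R C]

theorem polyToSeries_apply (a : R[X]) :
    polyToSeries R C a = ((a.map (algebraMap R C) : C[X]) : C⟦X⟧) := rfl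

@[simp] theorem polyToSeries_C (a : R) :
    polyToSeries R C (Polynomial.C a) = PowerSeries.C (algebraMap R C a) := by
  simp [polyToSeries_apply]

@[simp] theorem polyToSeries_X : polyToSeries R C Polynomial.X = PowerSeries.X := by
  simp [polyToSeries_apply]

end

theorem polyToSeries_injective (R C : Type*) [Field R] [Field C] [Algebra R C] :
    Function.Injective (polyToSeries R C) :=
  (Polynomial.coe_injective C).comp (Polynomial.map_injective _ (algebraMap R C).injective)

/-- This exhibits the twist as a ring homomorphism. -/
theorem twist_eq_map (Fq : Type*) {C : Type*} [Field Fq] [Fintype Fq] [NormedField C]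
    [Algebra Fq C] (f : C⟦X⟧) :
    twist (Fintype.card Fq) f = PowerSeries.map (frob Fq C 1 : C →+* C) f := by
  ext n
  simp [twist, frob_apply]

variable {C : Type*} [NormedField C]

theorem isRestricted_coe (ρ : ℝ) (p : C[X]) : PowerSeries.IsRestricted ρ (p : C⟦X⟧) := by
  refine (PowerSeries.isRestricted_iff' ρ _).2 (tendsto_const_nhds.congr' ?_)
  filter_upwards [eventually_gt_atTop p.natDegree] with n hn
  rw [Polynomial.coeff_coe, Polynomial.coeff_eq_zero_of_natDegree_lt hn, norm_zero, zero_mul]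

variable [IsUltrametricDist C]

theorem mem_tate_iff {f : C⟦X⟧} :
    f ∈ tate C ↔ Tendsto (fun n => PowerSeries.coeff n f) atTop (𝓝 0) := by
  refine (PowerSeries.isRestricted_iff' 1 f).trans ?_
  simp only [one_pow, mul_one]
  exact tendsto_zero_iff_norm_tendsto_zero.symm

theorem polyToSeries_mem_tate {R : Type*} [CommSemiring R] [Algebra R C] (a : R[X]) :
    polyToSeries R C a ∈ tate C :=
  isRestricted_coe 1 _

end Series

namespace TModule

section Pairing

variable {Fq K C : Type*} [Field Fq] [Fintype Fq] [Field K] [Algebra (RatFunc Fq) K]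
  {d : ℕ} {E : TModule Fq K d}

theorem poly_add (x y : E.Motive) : (x + y).poly = x.poly + y.poly := by
  simp [Motive.poly]

theorem poly_C_smul (a : K) (x : E.Motive) :
    Motive.poly (Polynomial.C a • x) = a • Motive.poly x := by
  rw [Module.AEval.C_smul]
  simp [Motive.poly]

theorem poly_X_smul (x : E.Motive) :
    Motive.poly ((Polynomial.X : K[X]) • x) = MvPolynomial.bind₁ E.phi x.poly := by
  rw [Motive.poly, Module.AEval'.of_symm_X_smul]
  rfl

theorem poly_mem (x : E.Motive) : x.poly ∈ homGa Fq K d := Subtype.property _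

theorem poly_injective : Function.Injective (Motive.poly (E := E)) := fun _ _ h =>
  (Module.AEval'.of E.tMul).symm.injective (Subtype.ext h)

theorem poly_tau (x : E.Motive) : (E.tau x).poly = x.poly ^ Fintype.card Fq := rfl

theorem tau_add [Algebra Fq K] (x y : E.Motive) : E.tau (x + y) = E.tau x + E.tau y := by
  refine poly_injective ?_
  simp only [poly_tau, poly_add]
  have := map_add (frob Fq (MvPolynomial (Fin d) K) 1) x.poly y.poly
  simpa [frob_apply] using this

theorem tau_C_smul (a : K) (x : E.Motive) :
    E.tau (Polynomial.C a • x) = Polynomial.C (a ^ Fintype.card Fq) • E.tau x := by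
  refine poly_injective ?_
  simp only [poly_tau, poly_C_smul, _root_.smul_pow]

theorem tau_X_smul (x : E.Motive) :
    E.tau ((Polynomial.X : K[X]) • x) = (Polynomial.X : K[X]) • E.tau x := by
  refine poly_injective ?_
  simp only [poly_tau, poly_X_smul, map_pow]

variable (E) in
/-- The `j`-th coordinate function of `E = 𝔾_a ^ d`. -/
def coord (j : Fin d) : E.Motive :=
  Module.AEval'.of E.tMul ⟨MvPolynomial.X j, Submodule.subset_span ⟨j, 0, by simp⟩⟩

@[simp] theorem poly_coord (j : Fin d) : (E.coord j).poly = MvPolynomial.X j := rfl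

variable [NormedField C] [Algebra K C]

/-- The values of an element of the motive at a sequence of points, as a power series. -/
def pairing (h : ℕ → Fin d → C) (x : E.Motive) : C⟦X⟧ :=
  PowerSeries.mk fun n => MvPolynomial.aeval (h n) x.poly

@[simp] theorem coeff_pairing (h : ℕ → Fin d → C) (x : E.Motive) (n : ℕ) :
    PowerSeries.coeff n (pairing h x) = MvPolynomial.aeval (h n) x.poly :=
  PowerSeries.coeff_mk _ _

theorem pairing_add (h : ℕ → Fin d → C) (x y : E.Motive) :
    pairing h (x + y) = pairing h x + pairing h y := by
  ext n
  simp [poly_add]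

theorem pairing_C_smul (h : ℕ → Fin d → C) (a : K) (x : E.Motive) :
    pairing h (Polynomial.C a • x) = PowerSeries.C (algebraMap K C a) * pairing h x := by
  ext n
  rw [PowerSeries.coeff_C_mul, coeff_pairing, poly_C_smul, map_smul, Algebra.smul_def,
    coeff_pairing]

theorem pairing_tau (h : ℕ → Fin d → C) (x : E.Motive) :
    pairing h (E.tau x) = twist (Fintype.card Fq) (pairing h x) := by
  ext n
  simp [twist, poly_tau]

theorem coeff_pairing_X_smul [Algebra Fq C] (h : ℕ → Fin d → C) (x : E.Motive) (n : ℕ) :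
    PowerSeries.coeff n (pairing h ((Polynomial.X : K[X]) • x)) =
      MvPolynomial.aeval (E.phiMap C (h n)) x.poly := by
  rw [coeff_pairing, poly_X_smul, MvPolynomial.aeval_bind₁]
  rfl

theorem aeval_zero_poly [Algebra Fq C] (x : E.Motive) :
    MvPolynomial.aeval (0 : Fin d → C) x.poly = 0 :=
  map_zero (evalGa (C := C) (poly_mem x))

section Torsion

variable [Algebra Fq C] {h : ℕ → Fin d → C} (h0 : E.phiMap C (h 0) = 0)
  (hs : ∀ n, E.phiMap C (h (n + 1)) = h n)

include h0 hs

/-- Applying $\phi_t$ moves the sequence down by one and kills its first term, exactly as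
multiplication by $t$ moves coefficients. -/
theorem pairing_X_smul (x : E.Motive) :
    pairing h ((Polynomial.X : K[X]) • x) = PowerSeries.X * pairing h x := by
  ext n
  rw [coeff_pairing_X_smul]
  cases n with
  | zero => rw [h0, aeval_zero_poly, PowerSeries.coeff_zero_X_mul]
  | succ n => rw [hs, PowerSeries.coeff_succ_X_mul, coeff_pairing]

theorem pairing_smul (a : K[X]) (x : E.Motive) :
    pairing h (a • x) = polyToSeries K C a * pairing h x := by
  induction a using Polynomial.induction_on generalizing x with
  | C a => rw [pairing_C_smul, polyToSeries_C]
  | add a b ha hb => rw [add_smul, pairing_add, ha, hb, map_add, add_mul]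
  | monomial n a ih =>
    rw [pow_succ, ← mul_assoc, mul_smul, ih, pairing_X_smul h0 hs, map_mul _ (_ * _), polyToSeries_X,
      mul_assoc]

theorem pairing_sum_smul {ι : Type*} (s : Finset ι) (a : ι → K[X]) (x : ι → E.Motive) :
    pairing h (∑ j ∈ s, a j • x j) = ∑ j ∈ s, polyToSeries K C (a j) * pairing h (x j) := by
  let f : E.Motive →+ C⟦X⟧ := AddMonoidHom.mk' (pairing h) (pairing_add h)
  exact (map_sum f _ _).trans (Finset.sum_congr rfl fun j _ => pairing_smul h0 hs _ _)

end Torsion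

theorem pairing_mem_tate [IsUltrametricDist C] {h : ℕ → Fin d → C}
    (hh : Tendsto h atTop (𝓝 0)) [Algebra Fq C] (x : E.Motive) : pairing h x ∈ tate C := by
  rw [mem_tate_iff]
  simp only [coeff_pairing]
  obtain ⟨D, hD⟩ := exists_aeval_expansion (C := C) (poly_mem x)
  have hc : Continuous fun y : Fin d → C => MvPolynomial.aeval y x.poly := by
    simp only [hD D le_rfl]
    fun_prop
  have := (hc.tendsto 0).comp hh
  rwa [aeval_zero_poly] at this

/-! ### Frobenius-equivariant maps from the motive to power series -/

/-- Both sides are additive in $x$ and semilinear over $K[t]$ for the same Frobenius on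
coefficients, so a basis suffices. -/
theorem map_tau_eq_twist [Algebra Fq K] [Algebra Fq C] {F : E.Motive → C⟦X⟧}
    (hadd : ∀ x y, F (x + y) = F x + F y) (hsmul : ∀ a x, F (a • x) = polyToSeries K C a * F x)
    {r : ℕ} (m : Module.Basis (Fin r) K[X] E.Motive)
    (hm : ∀ i, F (E.tau (m i)) = twist (Fintype.card Fq) (F (m i))) (x : E.Motive) :
    F (E.tau x) = twist (Fintype.card Fq) (F x) := by
  have hC : ∀ (a : K) (x : E.Motive), F (E.tau x) = twist (Fintype.card Fq) (F x) →
      F (E.tau (Polynomial.C a • x)) = twist (Fintype.card Fq) (F (Polynomial.C a • x)) := by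
    intro a x hx
    rw [tau_C_smul, hsmul, hx, hsmul, polyToSeries_C, polyToSeries_C, twist_eq_map, twist_eq_map,
      map_mul, PowerSeries.map_C]
    simp [frob_apply]
  have hX : ∀ x : E.Motive, F (E.tau x) = twist (Fintype.card Fq) (F x) →
      F (E.tau ((Polynomial.X : K[X]) • x)) =
        twist (Fintype.card Fq) (F ((Polynomial.X : K[X]) • x)) := by
    intro x hx
    rw [tau_X_smul, hsmul, hx, hsmul, polyToSeries_X, twist_eq_map, twist_eq_map, map_mul,
      PowerSeries.map_X]
  have hA : ∀ x y : E.Motive, F (E.tau x) = twist (Fintype.card Fq) (F x) →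
      F (E.tau y) = twist (Fintype.card Fq) (F y) →
      F (E.tau (x + y)) = twist (Fintype.card Fq) (F (x + y)) := by
    intro x y hx hy
    rw [tau_add, hadd, hx, hy, hadd, twist_eq_map, twist_eq_map, twist_eq_map, map_add]
  have hS : ∀ (a : K[X]) (x : E.Motive), F (E.tau x) = twist (Fintype.card Fq) (F x) →
      F (E.tau (a • x)) = twist (Fintype.card Fq) (F (a • x)) := by
    intro a
    induction a using Polynomial.induction_on with
    | C a => exact hC a
    | add a b ha hb =>
      intro x hx
      rw [add_smul]
      exact hA _ _ (ha x hx) (hb x hx)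
    | monomial n a ih =>
      intro x hx
      rw [pow_succ, ← mul_assoc, mul_smul]
      exact ih _ (hX x hx)
  have hx : x ∈ Submodule.span K[X] (Set.range m) := m.span_eq ▸ Submodule.mem_top
  induction hx using Submodule.span_induction with
  | mem x hx =>
    obtain ⟨i, rfl⟩ := hx
    exact hm i
  | zero =>
    have h0 : F 0 = 0 := by simpa using hsmul 0 0
    have h1 : E.tau 0 = 0 := by simpa [Fintype.card_ne_zero] using tau_C_smul (E := E) 0 0
    rw [h1, h0, twist_eq_map, map_zero]
  | add x y _ _ hx hy => exact hA x y hx hy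
  | smul a x _ hx => exact hS a x hx

/-- The coordinate functions generate the motive under $K$ and $\tau$, so $F$ is determined by its
values on them; the $n$-th coefficients of these values are the coordinates of the $n$-th point. -/
theorem eq_pairing_of_tau [Algebra Fq C] {F : E.Motive → C⟦X⟧}
    (hadd : ∀ x y, F (x + y) = F x + F y) (hsmul : ∀ a x, F (a • x) = polyToSeries K C a * F x)
    (htau : ∀ x, F (E.tau x) = twist (Fintype.card Fq) (F x)) (x : E.Motive) :
    F x = pairing (fun n j => PowerSeries.coeff n (F (E.coord j))) x := by
  set h : ℕ → Fin d → C := fun n j => PowerSeries.coeff n (F (E.coord j)) with hh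
  have key : ∀ (f : MvPolynomial (Fin d) K) (hf : f ∈ homGa Fq K d),
      F (Module.AEval'.of E.tMul ⟨f, hf⟩) = pairing h (Module.AEval'.of E.tMul ⟨f, hf⟩) := by
    intro f hf
    induction hf using Submodule.span_induction with
    | mem f hf =>
      obtain ⟨j, i, rfl⟩ := hf
      have hmem : ∀ i, (MvPolynomial.X j : MvPolynomial (Fin d) K) ^ Fintype.card Fq ^ i ∈
        homGa Fq K d := fun i => Submodule.subset_span ⟨j, i, rfl⟩
      have : ∀ i, F (Module.AEval'.of E.tMul ⟨_, hmem i⟩) =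
          pairing h (Module.AEval'.of E.tMul ⟨_, hmem i⟩) := by
        intro i
        induction i with
        | zero =>
          have h1 : Module.AEval'.of E.tMul ⟨_, hmem 0⟩ = E.coord j :=
            poly_injective (by rw [poly_coord]; simp [Motive.poly])
          rw [h1]
          ext n
          simp [hh]
        | succ i ih =>
          have h1 : Module.AEval'.of E.tMul ⟨_, hmem (i + 1)⟩ =
              E.tau (Module.AEval'.of E.tMul ⟨_, hmem i⟩) :=
            poly_injective (by rw [poly_tau]; simp [Motive.poly, pow_succ, pow_mul])
          rw [h1, htau, ih, pairing_tau]
      exact this i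
    | zero =>
      have h1 : Module.AEval'.of E.tMul ⟨0, Submodule.zero_mem _⟩ =
          (Polynomial.C (0 : K)) • (0 : E.Motive) :=
        poly_injective (by simp [Motive.poly])
      rw [h1, hsmul, pairing_C_smul, polyToSeries_C]
      simp
    | add f g hf hg ihf ihg =>
      have h1 : Module.AEval'.of E.tMul ⟨f + g, Submodule.add_mem _ hf hg⟩ =
          Module.AEval'.of E.tMul ⟨f, hf⟩ + Module.AEval'.of E.tMul ⟨g, hg⟩ := rfl
      rw [h1, hadd, pairing_add, ihf, ihg]
    | smul a f hf ih =>
      have h1 : Module.AEval'.of E.tMul ⟨a • f, Submodule.smul_mem _ a hf⟩ =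
          Polynomial.C a • Module.AEval'.of E.tMul ⟨f, hf⟩ := by
        rw [Module.AEval.C_smul]; rfl
      rw [h1, hsmul, pairing_C_smul, polyToSeries_C, ih]
  exact key x.poly (poly_mem x)

/-- The solution $v$ extends $K[t]$-linearly to a map on the motive. Compatibility with $\tau$ turns
it into evaluation at points, and compatibility with $t$ gives the torsion relations. -/
theorem exists_torsion_of_twist_eq [IsUltrametricDist C] [Algebra Fq K] [Algebra Fq C] {r : ℕ}
    (m : Module.Basis (Fin r) K[X] E.Motive) {Θ : Matrix (Fin r) (Fin r) K[X]}
    (hΘ : ∀ i, E.tau (m i) = ∑ j, Θ i j • m j) {v : Fin r → C⟦X⟧} (hv : ∀ i, v i ∈ tate C)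
    (htw : ∀ i, twist (Fintype.card Fq) (v i) = ∑ j, polyToSeries K C (Θ i j) * v j) :
    ∃ h : ℕ → Fin d → C, Tendsto h atTop (𝓝 0) ∧ E.phiMap C (h 0) = 0 ∧
      (∀ n, E.phiMap C (h (n + 1)) = h n) ∧ ∀ i, pairing h (m i) = v i := by
  let F : E.Motive → C⟦X⟧ := fun x => ∑ i, polyToSeries K C (m.repr x i) * v i
  have hadd : ∀ x y, F (x + y) = F x + F y := fun x y => by
    simp [F, add_mul, Finset.sum_add_distrib]
  have hsmul : ∀ a x, F (a • x) = polyToSeries K C a * F x := fun a x => by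
    simp [F, Finset.mul_sum, mul_assoc]
  have hFm : ∀ i, F (m i) = v i := fun i => by
    simp only [F]
    rw [Finset.sum_eq_single i] <;> simp +contextual
  have hFsum : ∀ a : Fin r → K[X], F (∑ j, a j • m j) = ∑ j, polyToSeries K C (a j) * v j :=
    fun a => by simp only [F, m.repr_sum_self]
  have htau := map_tau_eq_twist hadd hsmul m fun i => by
    rw [hΘ, hFsum, hFm, htw]
  have hF := eq_pairing_of_tau hadd hsmul htau
  -- Here $t$ times the $i$-th coordinate function is the $i$-th component of $\phi_t$.
  have hphi : ∀ n i, E.phiMap C (fun j => PowerSeries.coeff n (F (E.coord j))) i =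
      PowerSeries.coeff n (PowerSeries.X * F (E.coord i)) := by
    intro n i
    rw [← polyToSeries_X (R := K), ← hsmul, hF, coeff_pairing_X_smul, poly_coord,
      MvPolynomial.aeval_X]
  refine ⟨fun n j => PowerSeries.coeff n (F (E.coord j)), ?_, ?_, fun n => ?_, fun i => ?_⟩
  · refine tendsto_pi_nhds.2 fun j => mem_tate_iff.1 (Subring.sum_mem _ fun i _ => ?_)
    exact Subring.mul_mem _ (polyToSeries_mem_tate _) (hv i)
  · ext i
    rw [hphi, PowerSeries.coeff_zero_X_mul, Pi.zero_apply]
  · ext i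
    rw [hphi, PowerSeries.coeff_succ_X_mul]
  · rw [← hF, hFm]

end Pairing

end TModule

/-! ### Twist-invariant series -/

theorem exists_algebraMap_eq_of_pow_card_eq {Fq C : Type*} [Field Fq] [Fintype Fq] [Field C]
    [Algebra Fq C] {x : C} (hx : x ^ Fintype.card Fq = x) : ∃ c : Fq, algebraMap Fq C c = x := by
  have hsp : (Polynomial.X ^ Fintype.card Fq - Polynomial.X : Fq[X]).Splits := by
    simpa using Polynomial.IsSplittingField.splits (K := Fq) Fq
      (Polynomial.X ^ Fintype.card Fq - Polynomial.X)
  exact hsp.mem_range_of_isRoot (FiniteField.X_pow_card_sub_X_ne_zero Fq Fintype.one_lt_card)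
    (by simp [hx])

/-- The elements of the Tate algebra fixed by the twist are the polynomials over `𝔽_q`. -/
theorem exists_polyToSeries_eq_of_twist_eq {Fq C : Type*} [Field Fq] [Fintype Fq] [NormedField C]
    [IsUltrametricDist C] [Algebra Fq C] {f : C⟦X⟧} (hf : f ∈ tate C)
    (htw : twist (Fintype.card Fq) f = f) : ∃ p : Fq[X], polyToSeries Fq C p = f := by
  have hpow : ∀ n, PowerSeries.coeff n f ^ Fintype.card Fq = PowerSeries.coeff n f := fun n => by
    conv_rhs => rw [← htw]
    simp [twist]
  choose c hc using fun n => exists_algebraMap_eq_of_pow_card_eq (Fq := Fq) (hpow n)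
  -- A coefficient $x$ with $x^q=x$ has absolute value $0$ or $1$, so coefficients tending to $0$
  -- vanish eventually.
  obtain ⟨N, hN⟩ := ((mem_tate_iff.1 hf).norm.eventually_lt_const
    (show ‖(0 : C)‖ < 1 by simp)).exists_forall_of_atTop
  have hzero : ∀ n ≥ N, PowerSeries.coeff n f = 0 := by
    intro n hn
    by_contra h0
    have h1 := congrArg norm (hpow n)
    rw [norm_pow] at h1
    have h2 : ‖PowerSeries.coeff n f‖ ^ Fintype.card Fq < ‖PowerSeries.coeff n f‖ ^ 1 :=
      pow_lt_pow_right_of_lt_one₀ (norm_pos_iff.2 h0) (hN n hn) Fintype.one_lt_card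
    rw [pow_one] at h2
    exact h2.ne h1
  refine ⟨∑ n ∈ Finset.range N, Polynomial.monomial n (c n), ?_⟩
  ext n
  rw [polyToSeries_apply, Polynomial.coeff_coe, Polynomial.coeff_map, Polynomial.finsetSum_coeff]
  simp only [Polynomial.coeff_monomial, Finset.sum_ite_eq', Finset.mem_range]
  split_ifs with h
  · exact hc n
  · rw [map_zero, hzero n (by omega)]

namespace TModule

/-! ### Anderson generating functions -/

variable {Fq K C : Type*} [Field Fq] [Fintype Fq] [Field K] [Algebra (RatFunc Fq) K]
  {d : ℕ} (E : TModule Fq K d) [NormedField C] [Algebra K C]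

theorem dphi_X_apply (l : Fin d → C) : E.dphi C Polynomial.X l = E.lieMat C *ᵥ l := by
  simp only [dphi, lieMat, RingHom.comp_apply, Polynomial.coe_mapRingHom, Polynomial.map_X]
  exact congrArg (fun f : Module.End C (Fin d → C) => f l) (Polynomial.aeval_X _)

/-- The system of `t`-power torsion points attached to a period. -/
def torsion (l : Fin d → C) (n : ℕ) : Fin d → C := E.exp C ((E.lieMat C)⁻¹ ^ (n + 1) *ᵥ l)

/-- The value of an element of the motive at the Anderson generating function
`∑ exp (dφ_t ^ (-n - 1) l) t ^ n`. -/
def agf (l : Fin d → C) (x : E.Motive) : C⟦X⟧ :=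
  pairing (E.torsion l) x

theorem coeff_agf (l : Fin d → C) (x : E.Motive) (n : ℕ) :
    PowerSeries.coeff n (E.agf l x) = MvPolynomial.aeval (E.torsion l n) x.poly :=
  coeff_pairing _ _ _

theorem agf_tau (l : Fin d → C) (x : E.Motive) :
    E.agf l (E.tau x) = twist (Fintype.card Fq) (E.agf l x) :=
  pairing_tau _ _

variable [Algebra Fq C]

/-- The torsion system of $d\phi_t\,l$ is that of $l$ shifted by one, and its first entry is
$\exp_E(l)=0$. -/
theorem agf_lieMat_mulVec (hθ : ‖algebraMap K C (theta Fq K)‖ = Fintype.card Fq) {l : Fin d → C} (hl : E.exp C l = 0) (x : E.Motive) :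
    E.agf (E.lieMat C *ᵥ l) x = PowerSeries.X * E.agf l x := by
  have hcomm : ∀ n, (E.lieMat C)⁻¹ ^ (n + 1) *ᵥ (E.lieMat C *ᵥ l) = (E.lieMat C)⁻¹ ^ n *ᵥ l := by
    intro n
    rw [mulVec_mulVec, pow_succ, mul_assoc, nonsing_inv_mul _ (E.isUnit_det_lieMat hθ), mul_one]
  ext n
  rw [coeff_agf, torsion, hcomm]
  cases n with
  | zero => rw [pow_zero, one_mulVec, hl, aeval_zero_poly, PowerSeries.coeff_zero_X_mul]
  | succ n => rw [PowerSeries.coeff_succ_X_mul, coeff_agf, torsion]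

theorem dphi_C_apply [Algebra Fq K] [IsScalarTower Fq (RatFunc Fq) K] [IsScalarTower Fq K C]
    (c : Fq) (l : Fin d → C) : E.dphi C (Polynomial.C c) l = c • l := by
  have h : algebraMap K C (algebraMap (RatFunc Fq) K (algebraMap Fq (RatFunc Fq) c)) =
      algebraMap Fq C c := by
    rw [← IsScalarTower.algebraMap_apply Fq (RatFunc Fq) K, ← IsScalarTower.algebraMap_apply]
  rw [← algebraMap_smul C c l, ← h]
  simp only [dphi, RingHom.comp_apply, Polynomial.coe_mapRingHom, Polynomial.map_C]
  exact congrArg (fun f : Module.End C (Fin d → C) => f l) (Polynomial.aeval_C _ _)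

variable [Algebra Fq K] [IsUltrametricDist C] [CompleteSpace C]
  (P : InftyAbs Fq K) (hθ : ‖algebraMap K C (theta Fq K)‖ = Fintype.card Fq)

section

include P hθ

theorem agf_sum_smul {l : Fin d → C} (hl : E.exp C l = 0) {ι : Type*} (s : Finset ι)
    (a : ι → K[X]) (x : ι → E.Motive) :
    E.agf l (∑ j ∈ s, a j • x j) = ∑ j ∈ s, polyToSeries K C (a j) * E.agf l (x j) :=
  pairing_sum_smul (h := E.torsion l) (E.phiMap_torsion_zero P hθ hl)
    (E.phiMap_torsion_succ P hθ l) s a x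

/-- Vanishing on a basis forces vanishing on the coordinate functions, hence of every torsion point
$\exp_E(d\phi_t^{-n-1}l)$. -/
theorem agf_eq_zero {l : Fin d → C} {r : ℕ} (m : Module.Basis (Fin r) K[X] E.Motive)
    (hl : E.exp C l = 0) (h : ∀ i, E.agf l (m i) = 0) : l = 0 := by
  refine E.eq_zero_of_torsion_eq_zero P hθ fun n => ?_
  ext i
  have h1 : E.agf l (E.coord i) = 0 := by
    rw [← m.sum_repr (E.coord i), E.agf_sum_smul P hθ hl]
    exact Finset.sum_eq_zero fun j _ => by rw [h j, mul_zero]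
  have h2 := congrArg (PowerSeries.coeff n) h1
  rwa [coeff_agf, poly_coord, MvPolynomial.aeval_X, map_zero] at h2

theorem agf_mem_tate (l : Fin d → C) (x : E.Motive) : E.agf l x ∈ tate C :=
  pairing_mem_tate (E.tendsto_torsion P hθ l) x

theorem exists_agf_eq {r : ℕ} (m : Module.Basis (Fin r) K[X] E.Motive)
    {Θ : Matrix (Fin r) (Fin r) K[X]} (hΘ : ∀ i, E.tau (m i) = ∑ j, Θ i j • m j)
    {v : Fin r → C⟦X⟧} (hv : ∀ i, v i ∈ tate C)
    (htw : ∀ i, twist (Fintype.card Fq) (v i) = ∑ j, polyToSeries K C (Θ i j) * v j) :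
    ∃ l : Fin d → C, E.exp C l = 0 ∧ ∀ i, E.agf l (m i) = v i := by
  obtain ⟨h, ht, h0, hs, hm⟩ := exists_torsion_of_twist_eq m hΘ hv htw
  obtain ⟨l, hl, hl'⟩ := E.exists_period_of_torsion P hθ ht h0 hs
  refine ⟨l, hl, fun i => ?_⟩
  rw [← hm, agf, show h = E.torsion l from funext hl']

theorem agf_add (l l' : Fin d → C) (x : E.Motive) :
    E.agf (l + l') x = E.agf l x + E.agf l' x := by
  ext n
  rw [map_add, coeff_agf, coeff_agf, coeff_agf, torsion, mulVec_add, ← E.expLin_apply P hθ,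
    map_add]
  exact map_add (evalGa (C := C) (poly_mem x)) _ _

theorem agf_zero (x : E.Motive) : E.agf (0 : Fin d → C) x = 0 := by
  simpa using E.agf_add P hθ 0 0 x

theorem agf_smul (c : Fq) (l : Fin d → C) (x : E.Motive) :
    E.agf (c • l) x = PowerSeries.C (algebraMap Fq C c) * E.agf l x := by
  ext n
  rw [PowerSeries.coeff_C_mul, coeff_agf, coeff_agf, torsion, mulVec_smul,
    ← E.expLin_apply P hθ, map_smul, ← Algebra.smul_def]
  exact map_smul (evalGa (C := C) (poly_mem x)) _ _

end

variable [IsScalarTower Fq (RatFunc Fq) K] [IsScalarTower Fq K C]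

include P hθ

theorem exp_dphi_eq_zero (p : Fq[X]) {l : Fin d → C} (hl : E.exp C l = 0) :
    E.exp C (E.dphi C p l) = 0 := by
  induction p using Polynomial.induction_on generalizing l with
  | C c => rw [dphi_C_apply, ← E.expLin_apply P hθ, map_smul, expLin_apply, hl, smul_zero]
  | add a b ha hb =>
    rw [map_add, LinearMap.add_apply, ← E.expLin_apply P hθ, map_add, expLin_apply, expLin_apply,
      ha hl, hb hl, add_zero]
  | monomial n a ih =>
    rw [pow_succ, ← mul_assoc, map_mul _ (_ * _), Module.End.mul_apply]
    refine ih ?_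
    rw [dphi_X_apply, E.exp_lieMat_mulVec P hθ, hl, map_zero]

theorem agf_dphi (p : Fq[X]) {l : Fin d → C} (hl : E.exp C l = 0) (x : E.Motive) :
    E.agf (E.dphi C p l) x = polyToSeries Fq C p * E.agf l x := by
  induction p using Polynomial.induction_on generalizing l with
  | C c => rw [dphi_C_apply, E.agf_smul P hθ, polyToSeries_C]
  | add a b ha hb => rw [map_add, LinearMap.add_apply, E.agf_add P hθ, ha hl, hb hl, map_add, add_mul]
  | monomial n a ih =>
    have hl' : E.exp C (E.lieMat C *ᵥ l) = 0 := by
      rw [E.exp_lieMat_mulVec P hθ, hl, map_zero]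
    rw [pow_succ, ← mul_assoc, map_mul _ (_ * _), Module.End.mul_apply, dphi_X_apply, ih hl',
      E.agf_lieMat_mulVec hθ hl, map_mul _ (_ * _), polyToSeries_X, mul_assoc]

omit P hθ

/-- The period lattice as an `𝔽_q[t]`-module. -/
def periodSubmodule : Submodule Fq[X] (E.Lie C) where
  carrier := E.periodLattice C
  zero_mem' := map_zero (E.expLin P hθ)
  add_mem' {x y} hx hy := by
    have h := map_add (E.expLin P hθ) (show Fin d → C from x) (show Fin d → C from y)
    rw [expLin_apply, expLin_apply, expLin_apply, show E.exp C x = 0 from hx,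
      show E.exp C y = 0 from hy, add_zero] at h
    exact h
  smul_mem' p _ hx := E.exp_dphi_eq_zero P hθ p hx

include P hθ

theorem agf_sum_smul_lie (x : E.Motive) {ι : Type*} (s : Finset ι) (c : ι → Fq[X])
    (l : ι → E.Lie C) (hl : ∀ i, E.exp C (l i) = 0) :
    E.agf (∑ i ∈ s, c i • l i : E.Lie C) x =
      ∑ i ∈ s, polyToSeries Fq C (c i) * E.agf (l i) x := by
  let f : E.Lie C →+ C⟦X⟧ := AddMonoidHom.mk' (fun l => E.agf l x)
    fun a b => E.agf_add P hθ a b x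
  exact (map_sum f _ _).trans (Finset.sum_congr rfl fun i _ => E.agf_dphi P hθ _ (hl i) x)

/-- The columns of the inverse of a rigid analytic trivialization correspond to a basis of the
period lattice. -/
theorem exists_basis_periodLattice {r : ℕ} (m : Module.Basis (Fin r) K[X] E.Motive)
    {Θ : Matrix (Fin r) (Fin r) K[X]} (hΘ : ∀ i, E.tau (m i) = ∑ j, Θ i j • m j)
    (Υ : GL (Fin r) (tate C))
    (hΥ : (Υ.val.map fun f => twist (Fintype.card Fq) f.val) * Θ.map (polyToSeries K C) =
      Υ.val.map Subtype.val) :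
    ∃ l : Fin r → E.Lie C, LinearIndependent Fq[X] l ∧
      (Submodule.span Fq[X] (Set.range l) : Set (E.Lie C)) = E.periodLattice C ∧
      (∀ j, E.exp C (l j) = 0) ∧ ∀ i j, E.agf (l j) (m i) = ((Υ⁻¹).val i j : C⟦X⟧) := by
  let σ : C⟦X⟧ →+* C⟦X⟧ := PowerSeries.map (frob Fq C 1 : C →+* C)
  let U : Matrix (Fin r) (Fin r) C⟦X⟧ := Υ.val.map Subtype.val
  let V : Matrix (Fin r) (Fin r) C⟦X⟧ := (Υ⁻¹).val.map Subtype.val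
  have hUV : U * V = 1 := by
    have := congrArg (tate C).subtype.mapMatrix Υ.mul_inv
    rwa [map_mul, map_one] at this
  have hVU : V * U = 1 := mul_eq_one_comm.1 hUV
  have hσU : U.map σ * Θ.map (polyToSeries K C) = U := by
    change _ = Υ.val.map Subtype.val
    rw [← hΥ]
    congr 1
    ext1 i j
    exact (twist_eq_map Fq _).symm
  have hσUV : U.map σ * V.map σ = 1 := by
    have := congrArg σ.mapMatrix hUV
    rwa [map_mul, map_one] at this
  have hσV : V.map σ = Θ.map (polyToSeries K C) * V := by
    -- Inverting $\tau(\Upsilon)\Theta=\Upsilon$ gives $\tau(\Upsilon^{-1})=\Theta\Upsilon^{-1}$,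
    -- the equation satisfied by generating functions of periods.
    calc V.map σ = V.map σ * (U.map σ * Θ.map (polyToSeries K C) * V) := by
          rw [hσU, hUV, mul_one]
      _ = _ := by rw [← mul_assoc, ← mul_assoc, mul_eq_one_comm.1 hσUV, one_mul]
  have hex : ∀ j, ∃ l : E.Lie C, E.exp C l = 0 ∧ ∀ i, E.agf l (m i) = V i j := by
    intro j
    refine E.exists_agf_eq P hθ m hΘ (fun i => ((Υ⁻¹).val i j).2) fun i => ?_
    have := congrFun (congrFun hσV i) j
    rw [mul_apply] at this
    rw [twist_eq_map]
    exact this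
  choose l hl hlV using hex
  have hagf : ∀ (c : Fin r → Fq[X]) (i : Fin r),
      E.agf (∑ j, c j • l j : E.Lie C) (m i) =
        (V *ᵥ fun j => polyToSeries Fq C (c j)) i := by
    intro c i
    rw [E.agf_sum_smul_lie P hθ _ _ _ _ hl]
    exact Finset.sum_congr rfl fun j _ => by rw [hlV, mul_comm]
  refine ⟨l, ?_, ?_, hl, fun i j => hlV j i⟩
  · rw [Fintype.linearIndependent_iff]
    intro c hc j
    have h1 : V *ᵥ (fun j => polyToSeries Fq C (c j)) = 0 := by
      ext1 i
      rw [← hagf, hc]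
      exact E.agf_zero P hθ (m i)
    have h2 := congrArg (U *ᵥ ·) h1
    simp only [mulVec_mulVec, hUV, one_mulVec, mulVec_zero] at h2
    exact polyToSeries_injective Fq C ((congrFun h2 j).trans (map_zero _).symm)
  · refine Set.Subset.antisymm ?_ fun x hx => ?_
    · change Submodule.span Fq[X] (Set.range l) ≤ E.periodSubmodule P hθ
      rw [Submodule.span_le]
      rintro _ ⟨j, rfl⟩
      exact hl j
    · have hx0 : E.exp C x = 0 := hx
      let v : Fin r → C⟦X⟧ := fun i => E.agf x (m i)
      have hσv : ∀ i, σ (v i) = (Θ.map (polyToSeries K C) *ᵥ v) i := by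
        intro i
        refine (twist_eq_map Fq _).symm.trans ((E.agf_tau x (m i)).symm.trans ?_)
        rw [hΘ]
        exact E.agf_sum_smul P hθ hx0 Finset.univ (Θ i) m
      -- For the vector $v$ of any period, $\tau(\Upsilon v)=\tau(\Upsilon)\Theta v=\Upsilon v$, so
      -- $\Upsilon v$ is polynomial over $\mathbb F_q$ and supplies the coordinates of the period.
      have hw : ∀ i, ∃ p : Fq[X], polyToSeries Fq C p = (U *ᵥ v) i := by
        intro i
        refine exists_polyToSeries_eq_of_twist_eq ?_ ?_
        · have hU : ∀ j, U i j ∈ tate C := fun j => (Υ.val i j).2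
          have hvm : ∀ j, v j ∈ tate C := fun j => E.agf_mem_tate P hθ x (m j)
          rw [mulVec, dotProduct]
          exact Subring.sum_mem _ fun j _ => Subring.mul_mem _ (hU j) (hvm j)
        · rw [twist_eq_map]
          calc σ ((U *ᵥ v) i) = (U.map σ *ᵥ fun j => σ (v j)) i := by
                simp only [mulVec, dotProduct, map_sum, map_mul, map_apply]
            _ = _ := by
                rw [show (fun j => σ (v j)) = Θ.map (polyToSeries K C) *ᵥ v from funext hσv,
                  mulVec_mulVec, hσU]
      choose c hc using hw
      have hv : V *ᵥ (fun j => polyToSeries Fq C (c j)) = v := by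
        rw [show (fun j => polyToSeries Fq C (c j)) = U *ᵥ v from funext hc, mulVec_mulVec, hVU,
          one_mulVec]
      have hmem : ∑ j, c j • l j ∈ E.periodSubmodule P hθ :=
        Submodule.sum_mem _ fun j _ => Submodule.smul_mem _ _ (hl j)
      have heq : x - ∑ j, c j • l j = 0 := by
        refine E.agf_eq_zero P hθ m (Submodule.sub_mem (E.periodSubmodule P hθ) hx0 hmem)
          fun i => ?_
        have h1 := E.agf_add P hθ (x - ∑ j, c j • l j : E.Lie C)
          (∑ j, c j • l j : E.Lie C) (m i)
        rw [hagf, hv] at h1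
        have h2 : E.agf ((x - ∑ j, c j • l j) + ∑ j, c j • l j : E.Lie C)
          (m i) = v i := by rw [sub_add_cancel]
        exact left_eq_add.1 (h2.symm.trans (h1.trans (add_comm _ _)))
      rw [sub_eq_zero.1 heq]
      exact Submodule.sum_mem _ fun j _ =>
        Submodule.smul_mem _ _ (Submodule.subset_span ⟨j, rfl⟩)

end TModule

/-! ### Expansions at a point and residues -/

section Residue

variable {C : Type*} [NormedField C]

theorem coeff_taylorAt (a : C) (g : C⟦X⟧) (k : ℕ) : PowerSeries.coeff k (taylorAt a g) =
    ∑' i : ℕ, ((i + k).choose k : C) * PowerSeries.coeff (i + k) g * a ^ i :=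
  PowerSeries.coeff_mk _ _

theorem coeff_taylorAt_of_eq_zero (a : C) {g : C⟦X⟧} {k : ℕ}
    (hg : ∀ n > k, PowerSeries.coeff n g = 0) :
    PowerSeries.coeff k (taylorAt a g) = PowerSeries.coeff k g := by
  rw [coeff_taylorAt, tsum_eq_single 0]
  · simp
  · intro i hi
    rw [hg (i + k) (by omega), mul_zero, zero_mul]

theorem taylorAt_one (a : C) : taylorAt a (1 : C⟦X⟧) = 1 := by
  ext k
  rw [coeff_taylorAt_of_eq_zero]
  intro n hn
  rw [PowerSeries.coeff_one, if_neg (by omega)]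

theorem isRestricted_X_sub_C_pow (ρ : ℝ) (a : C) (n : ℕ) :
    PowerSeries.IsRestricted ρ ((PowerSeries.X - PowerSeries.C a : C⟦X⟧) ^ n) := by
  have := isRestricted_coe ρ ((Polynomial.X - Polynomial.C a : C[X]) ^ n)
  simpa using this

variable [IsUltrametricDist C] [CompleteSpace C] {a : C} {ρ : ℝ} (ha : ‖a‖ < ρ)

include ha

/-- Binomial coefficients have norm at most $1$, so the terms are dominated by a geometric series of
ratio $\|a\|/\rho$. -/
theorem hasSum_taylorAt {g : C⟦X⟧} (hg : PowerSeries.IsRestricted ρ g) (k : ℕ) :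
    HasSum (fun i : ℕ => ((i + k).choose k : C) * PowerSeries.coeff (i + k) g * a ^ i)
      (PowerSeries.coeff k (taylorAt a g)) := by
  have hρ : 0 < ρ := (norm_nonneg a).trans_lt ha
  obtain ⟨b, hb⟩ := ((PowerSeries.isRestricted_iff' ρ g).1 hg).bddAbove_range
  rw [coeff_taylorAt]
  refine Summable.hasSum (Summable.of_norm_bounded (g := fun i => b / ρ ^ k * (‖a‖ / ρ) ^ i)
    ((summable_geometric_of_lt_one (by positivity) ((div_lt_one hρ).2 ha)).mul_left _)
    fun i => ?_)
  have h1 : ‖PowerSeries.coeff (i + k) g‖ * ρ ^ (i + k) ≤ b := hb ⟨i + k, rfl⟩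
  rw [← le_div_iff₀ (by positivity)] at h1
  calc _ ≤ 1 * (b / ρ ^ (i + k)) * ‖a‖ ^ i := by
        rw [norm_mul, norm_mul, norm_pow]
        gcongr
        exact IsUltrametricDist.norm_natCast_le_one C _
    _ = _ := by rw [pow_add, div_pow]; field_simp

theorem taylorAt_add {g g' : C⟦X⟧} (hg : PowerSeries.IsRestricted ρ g)
    (hg' : PowerSeries.IsRestricted ρ g') :
    taylorAt a (g + g') = taylorAt a g + taylorAt a g' := by
  ext k
  rw [coeff_taylorAt, map_add,
    ← ((hasSum_taylorAt ha hg k).add (hasSum_taylorAt ha hg' k)).tsum_eq]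
  refine tsum_congr fun i => ?_
  rw [map_add]
  ring

/-- Pascal's rule splits the coefficients of $t\,g$; the part with the unlowered index cancels
against $a\,g$. -/
theorem taylorAt_X_sub_C_mul {g : C⟦X⟧} (hg : PowerSeries.IsRestricted ρ g) :
    taylorAt a ((PowerSeries.X - PowerSeries.C a) * g) = PowerSeries.X * taylorAt a g := by
  ext k
  rw [coeff_taylorAt]
  cases k with
  | zero =>
    rw [PowerSeries.coeff_zero_X_mul]
    have h0 := (hasSum_taylorAt ha hg 0).mul_left a
    have h1 : HasSum (fun i => PowerSeries.coeff i (PowerSeries.X * g) * a ^ i)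
        (a * PowerSeries.coeff 0 (taylorAt a g)) := by
      rw [← hasSum_nat_add_iff' 1]
      simp only [Finset.sum_range_one, PowerSeries.coeff_zero_X_mul, zero_mul, sub_zero,
        PowerSeries.coeff_succ_X_mul]
      convert! h0 using 1
      ext1 i
      simp only [add_zero, Nat.choose_zero_right, Nat.cast_one, one_mul]
      ring
    refine Eq.trans (tsum_congr fun i => ?_) ((h1.sub h0).tsum_eq.trans (sub_self _))
    simp only [add_zero, Nat.choose_zero_right, Nat.cast_one, one_mul, sub_mul, map_sub,
      PowerSeries.coeff_C_mul]
    ring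
  | succ j =>
    rw [PowerSeries.coeff_succ_X_mul]
    have h0 := (hasSum_taylorAt ha hg (j + 1)).mul_left a
    have h1 : HasSum (fun i => ((i + j).choose (j + 1) : C) * PowerSeries.coeff (i + j) g * a ^ i)
        (a * PowerSeries.coeff (j + 1) (taylorAt a g)) := by
      rw [← hasSum_nat_add_iff' 1]
      simp only [Finset.sum_range_one, zero_add, Nat.choose_succ_self, Nat.cast_zero, zero_mul,
        sub_zero]
      convert! h0 using 1
      ext1 i
      rw [show i + 1 + j = i + (j + 1) by omega]
      ring
    refine Eq.trans (tsum_congr fun i => ?_)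
      ((((hasSum_taylorAt ha hg j).add h1).sub h0).tsum_eq.trans (add_sub_cancel_right _ _))
    rw [sub_mul, map_sub, PowerSeries.coeff_C_mul, ← add_assoc, PowerSeries.coeff_succ_X_mul,
      Nat.choose_succ_succ']
    push_cast
    ring

theorem taylorAt_X_sub_C_pow_mul {g : C⟦X⟧} (hg : PowerSeries.IsRestricted ρ g) (n : ℕ) :
    taylorAt a ((PowerSeries.X - PowerSeries.C a) ^ n * g) =
      PowerSeries.X ^ n * taylorAt a g := by
  induction n with
  | zero => simp
  | succ n ih =>
    rw [pow_succ', mul_assoc, taylorAt_X_sub_C_mul ha, ih, ← mul_assoc, ← pow_succ']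
    exact PowerSeries.isRestricted.mul ρ (isRestricted_X_sub_C_pow ρ a n) hg

/-- Recentred at $a$, the denominator is $X^Q$ and the term with $R$ starts in degree $Q$. The
coefficient of `p` in degree $Q-1$ is unchanged by recentring because no higher one exists. -/
theorem hasResidueAt_of_principal_part {Q : ℕ} (hQ : 0 < Q) {F R : C⟦X⟧} {p : C[X]}
    (hp : ∀ n ≥ Q, p.coeff n = 0) (hR : PowerSeries.IsRestricted ρ R)
    (hF : (PowerSeries.X - PowerSeries.C a) ^ Q * F =
      (p : C⟦X⟧) + (PowerSeries.X - PowerSeries.C a) ^ Q * R) :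
    HasResidueAt (HahnSeries.ofPowerSeries ℤ C F) a (p.coeff (Q - 1)) := by
  have hXR := PowerSeries.isRestricted.mul ρ (isRestricted_X_sub_C_pow ρ a Q) hR
  refine ⟨ρ, ha, (p : C⟦X⟧) + (PowerSeries.X - PowerSeries.C a) ^ Q * R,
    (PowerSeries.X - PowerSeries.C a) ^ Q, PowerSeries.isRestricted.add ρ (isRestricted_coe ρ p)
      hXR, isRestricted_X_sub_C_pow ρ a Q, ?_, ?_, ?_⟩
  · have := pow_ne_zero Q (Polynomial.X_sub_C_ne_zero a)
    simpa using (Polynomial.coe_injective C).ne this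
  · rw [← map_mul, hF]
  · have h1 : taylorAt a ((PowerSeries.X - PowerSeries.C a) ^ Q) = PowerSeries.X ^ Q := by
      have := taylorAt_X_sub_C_pow_mul ha (PowerSeries.isRestricted_one ρ) Q
      rwa [mul_one, taylorAt_one, mul_one] at this
    rw [h1, taylorAt_add ha (isRestricted_coe ρ p) hXR, taylorAt_X_sub_C_pow_mul ha hR,
      HahnSeries.ofPowerSeries_X_pow, div_eq_mul_inv, HahnSeries.inv_single,
      show (-1 : ℤ) = ((Q - 1 : ℕ) : ℤ) + -(Q : ℤ) by omega, HahnSeries.coeff_mul_single_add,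
      HahnSeries.ofPowerSeries_apply_coeff, inv_one, mul_one, map_add,
      PowerSeries.coeff_X_pow_mul', if_neg (by omega), add_zero, coeff_taylorAt_of_eq_zero,
      Polynomial.coeff_coe]
    intro n hn
    rw [Polynomial.coeff_coe, hp n (by omega)]

end Residue

/-! ### Residues of Anderson generating functions -/

theorem X_sub_C_pow_card_pow (Fq : Type*) {C : Type*} [Field Fq] [Fintype Fq] [CommRing C]
    [Algebra Fq C] (a : C) (k : ℕ) :
    (PowerSeries.X - PowerSeries.C a : C⟦X⟧) ^ Fintype.card Fq ^ k =
      PowerSeries.X ^ Fintype.card Fq ^ k - PowerSeries.C (a ^ Fintype.card Fq ^ k) := by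
  rw [← frob_apply, map_sub, frob_apply, frob_apply, map_pow]

/-- A homomorphism `𝔾_a ^ d → 𝔾_a` agrees with its differential up to terms of order `q`. -/
theorem exists_norm_aeval_sub_le {Fq K C : Type*} [Field Fq] [Fintype Fq] [Field K] {d : ℕ}
    [NormedField C] [IsUltrametricDist C] [Algebra K C] {f : MvPolynomial (Fin d) K}
    (hf : f ∈ homGa Fq K d) :
    ∃ c : ℝ, 0 ≤ c ∧ ∀ x : Fin d → C, ‖x‖ ≤ 1 →
      ‖MvPolynomial.aeval x f -
        (fun j => algebraMap K C (MvPolynomial.coeff (Finsupp.single j 1) f)) ⬝ᵥ x‖ ≤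
      c * ‖x‖ ^ Fintype.card Fq := by
  obtain ⟨D, hD⟩ := exists_aeval_expansion (C := C) hf
  obtain ⟨c, hc1, hc⟩ := exists_one_le_bound fun s : Fin (D + 1) × Fin d =>
    ‖algebraMap K C (MvPolynomial.coeff (Finsupp.single s.2 (Fintype.card Fq ^ (s.1 : ℕ))) f)‖
  refine ⟨c, by positivity, fun x hx => ?_⟩
  have h0 : (0 : ℝ) ≤ c * ‖x‖ ^ Fintype.card Fq := by positivity
  rw [hD (D + 1) (by omega), Finset.sum_range_succ']
  simp only [pow_zero, pow_one, dotProduct, add_sub_cancel_right]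
  refine IsUltrametricDist.norm_sum_le_of_forall_le_of_nonneg h0 fun k hk => ?_
  refine IsUltrametricDist.norm_sum_le_of_forall_le_of_nonneg h0 fun j _ => ?_
  rw [Finset.mem_range] at hk
  rw [norm_mul, norm_pow]
  refine mul_le_mul (hc (⟨k + 1, by omega⟩, j)) ?_ (by positivity) (by positivity)
  calc ‖x j‖ ^ Fintype.card Fq ^ (k + 1) ≤ ‖x‖ ^ Fintype.card Fq ^ (k + 1) := by
        gcongr
        exact norm_le_pi_norm x j
    _ ≤ _ := pow_le_pow_of_le_one (norm_nonneg _) hx (Nat.le_self_pow (Nat.succ_ne_zero k) _)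

namespace TModule

variable {Fq K C : Type*} [Field Fq] [Fintype Fq] [Field K] [Algebra (RatFunc Fq) K]
  {d : ℕ} (E : TModule Fq K d) [NormedField C] [Algebra K C] [Algebra Fq C]
  [Algebra Fq K] [IsUltrametricDist C] [CompleteSpace C]
  (P : InftyAbs Fq K) (hθ : ‖algebraMap K C (theta Fq K)‖ = Fintype.card Fq)

include P hθ

/-- Both $\exp_E$ and $x$ agree with their differentials up to order $q$, and they are evaluated
near $y=d\phi_t^{-n-1}l=O(q^{-n})$; the total error is $O(\|y\|^q)$. -/
theorem exists_norm_coeff_agf_sub_le (l : Fin d → C) (x : E.Motive) :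
    ∃ b : ℝ, ∀ᶠ n in atTop, ‖PowerSeries.coeff n (E.agf l x) -
      (fun j => algebraMap K C (MvPolynomial.coeff (Finsupp.single j 1) x.poly)) ⬝ᵥ
        ((E.lieMat C)⁻¹ ^ (n + 1) *ᵥ l)‖ ≤
      b * ((Fintype.card Fq : ℝ) ^ Fintype.card Fq)⁻¹ ^ n := by
  obtain ⟨c₁, hc₁, h₁⟩ := exists_norm_aeval_sub_le (C := C) (poly_mem x)
  obtain ⟨c₂, hc₂, h₂⟩ := E.exists_norm_exp_sub_le (C := C) P hθ
  obtain ⟨c₃, hc₃, h₃⟩ := E.exists_norm_inv_pow_mulVec_le hθ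
  obtain ⟨c₄, hc₄, h₄⟩ := exists_one_le_bound fun j : Fin d =>
    ‖algebraMap K C (MvPolynomial.coeff (Finsupp.single j 1) x.poly)‖
  set w : Fin d → C := fun j => algebraMap K C (MvPolynomial.coeff (Finsupp.single j 1) x.poly)
  have hw : ∀ y : Fin d → C, ‖w ⬝ᵥ y‖ ≤ c₄ * ‖y‖ := fun y =>
    IsUltrametricDist.norm_sum_le_of_forall_le_of_nonneg (by positivity) fun j _ => by
      rw [norm_mul]
      exact mul_le_mul (h₄ j) (norm_le_pi_norm y j) (norm_nonneg _) (by positivity)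
  have ht := (E.tendsto_inv_pow_mulVec hθ l).comp (tendsto_add_atTop_nat 1)
  set q := Fintype.card Fq with hq
  have hq0 : (0 : ℝ) < q := by exact_mod_cast Fintype.card_pos
  have hq1 : (1 : ℝ) ≤ q := by exact_mod_cast Fintype.card_pos
  refine ⟨(c₁ * c₂ ^ q + c₄ * c₂) * (c₃ * ‖l‖) ^ q, ?_⟩
  -- Once $\|y\|\le 1/c_2$, also $\|\exp_E(y)\|\le1$, so the estimate for $x$ applies at
  -- $\exp_E(y)$.
  filter_upwards [ht.norm.eventually_le_const (show ‖(0 : Fin d → C)‖ < c₂⁻¹ by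
    rw [norm_zero]; positivity)] with n hn
  set y : Fin d → C := (E.lieMat C)⁻¹ ^ (n + 1) *ᵥ l with hy
  have hyc : ‖y‖ ≤ c₂⁻¹ := hn
  have hy1 : ‖y‖ ≤ 1 := hyc.trans (inv_le_one_of_one_le₀ hc₂)
  have hexp : ‖E.exp C y‖ ≤ c₂ * ‖y‖ := by
    have h5 : ‖E.exp C y - y‖ ≤ c₂ * ‖y‖ :=
      (h₂ y hy1).trans (mul_le_mul_of_nonneg_left
        (pow_le_of_le_one (norm_nonneg _) hy1 Fintype.card_ne_zero) (by positivity))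
    have h6 : ‖y‖ ≤ c₂ * ‖y‖ := le_mul_of_one_le_left (norm_nonneg _) hc₂
    rw [← sub_add_cancel (E.exp C y) y]
    exact (IsUltrametricDist.norm_add_le_max _ _).trans (max_le h5 h6)
  have hexp1 : ‖E.exp C y‖ ≤ 1 := by
    refine hexp.trans ?_
    calc c₂ * ‖y‖ ≤ c₂ * c₂⁻¹ := by gcongr
      _ = 1 := mul_inv_cancel₀ (by positivity)
  have hyn : ‖y‖ ^ q ≤ (c₃ * ‖l‖) ^ q * ((q : ℝ) ^ q)⁻¹ ^ n := by
    calc ‖y‖ ^ q ≤ (c₃ * (q : ℝ)⁻¹ ^ (n + 1) * ‖l‖) ^ q := by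
          gcongr
          exact h₃ (n + 1) l
      _ ≤ (c₃ * (q : ℝ)⁻¹ ^ n * ‖l‖) ^ q := by
          have : (q : ℝ)⁻¹ ^ (n + 1) ≤ (q : ℝ)⁻¹ ^ n :=
            pow_le_pow_of_le_one (by positivity) (inv_le_one_of_one_le₀ hq1) (by omega)
          gcongr
      _ = _ := by rw [← inv_pow, ← pow_mul, mul_comm q n, pow_mul, ← mul_pow]; ring
  calc ‖PowerSeries.coeff n (E.agf l x) - w ⬝ᵥ y‖
      = ‖(MvPolynomial.aeval (E.exp C y) x.poly - w ⬝ᵥ E.exp C y) +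
          w ⬝ᵥ (E.exp C y - y)‖ := by
        rw [coeff_agf, dotProduct_sub, sub_add_sub_cancel]; rfl
    _ ≤ c₁ * (c₂ * ‖y‖) ^ q + c₄ * (c₂ * ‖y‖ ^ q) := by
        refine (norm_add_le _ _).trans (add_le_add ?_ ?_)
        · exact (h₁ _ hexp1).trans (by gcongr)
        · exact (hw _).trans (by gcongr; exact h₂ y hy1)
    _ = (c₁ * c₂ ^ q + c₄ * c₂) * ‖y‖ ^ q := by ring
    _ ≤ _ := by
        rw [mul_assoc]
        gcongr

/-- The residue at `θ` of an Anderson generating function. -/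
theorem hasResidueAt_agf (l : Fin d → C) (x : E.Motive) :
    HasResidueAt (HahnSeries.ofPowerSeries ℤ C (E.agf l x)) (algebraMap K C (theta Fq K))
      (-((fun j => algebraMap K C (MvPolynomial.coeff (Finsupp.single j 1) x.poly)) ⬝ᵥ l)) := by
  obtain ⟨b, hb⟩ := E.exists_norm_coeff_agf_sub_le P hθ l x
  obtain ⟨k, hk⟩ := E.exists_lieMat_pow (C := C)
  set w : Fin d → C := fun j => algebraMap K C (MvPolynomial.coeff (Finsupp.single j 1) x.poly)
  set a := algebraMap K C (theta Fq K)
  have hQ0 : 0 < Fintype.card Fq ^ k := pow_pos Fintype.card_pos _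
  have hpow := X_sub_C_pow_card_pow Fq a k
  set q := Fintype.card Fq
  set Q := q ^ k
  have hq1 : 1 < q := Fintype.one_lt_card
  have hqq : (q : ℝ) < (q : ℝ) ^ q := lt_self_pow₀ (by exact_mod_cast hq1) hq1
  -- The remainder has coefficients $O(q^{-qn})$, hence converges for every radius below $q^q$,
  -- which exceeds $|\theta|=q$.
  obtain ⟨ρ, hρ, hρ'⟩ := exists_between hqq
  have hρ0 : 0 < ρ := (Nat.cast_nonneg q).trans_lt hρ
  -- `G` is the linearized generating function. Since $d\phi_t^Q=\theta^Q$ and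
  -- $(t-\theta)^Q=t^Q-\theta^Q$, multiplication by $(t-\theta)^Q$ leaves only the first $Q$
  -- coefficients, the polynomial `p`.
  let G : C⟦X⟧ := PowerSeries.mk fun n => w ⬝ᵥ ((E.lieMat C)⁻¹ ^ (n + 1) *ᵥ l)
  let p : C[X] := ∑ n ∈ Finset.range Q,
    Polynomial.monomial n (-(a ^ Q * w ⬝ᵥ ((E.lieMat C)⁻¹ ^ (n + 1) *ᵥ l)))
  have hpcoeff : ∀ n, p.coeff n =
      if n < Q then -(a ^ Q * w ⬝ᵥ ((E.lieMat C)⁻¹ ^ (n + 1) *ᵥ l)) else 0 := fun n => by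
    simp only [p, Polynomial.finsetSum_coeff, Polynomial.coeff_monomial, Finset.sum_ite_eq',
      Finset.mem_range]
  have hQmul : ∀ n, a ^ Q * w ⬝ᵥ ((E.lieMat C)⁻¹ ^ (n + Q) *ᵥ l) =
      w ⬝ᵥ ((E.lieMat C)⁻¹ ^ n *ᵥ l) := fun n => by
    have h1 := E.pow_mulVec_inv_pow hθ Q ((E.lieMat C)⁻¹ ^ n *ᵥ l)
    rw [hk, smul_mulVec, one_mulVec, mulVec_mulVec, ← pow_add, add_comm Q n] at h1
    rw [← smul_eq_mul, ← dotProduct_smul, h1]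
  have hG : (PowerSeries.X - PowerSeries.C a) ^ Q * G = (p : C⟦X⟧) := by
    ext n
    rw [hpow, sub_mul, map_sub, PowerSeries.coeff_C_mul, PowerSeries.coeff_X_pow_mul',
      Polynomial.coeff_coe, hpcoeff]
    simp only [G, PowerSeries.coeff_mk]
    rcases lt_or_ge n Q with h | h
    · rw [if_neg (by omega), if_pos h, zero_sub]
    · rw [if_pos h, if_neg (by omega), ← hQmul (n - Q + 1), sub_eq_zero]
      congr 4
      omega
  have hres : p.coeff (Q - 1) = -(w ⬝ᵥ l) := by
    have h1 := hQmul 0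
    rw [zero_add, pow_zero, one_mulVec] at h1
    rw [hpcoeff, if_pos (by omega), Nat.sub_add_cancel hQ0, h1]
  rw [← hres]
  refine hasResidueAt_of_principal_part (ρ := ρ) (R := E.agf l x - G) (by rwa [hθ]) hQ0
    (fun n hn => by rw [hpcoeff, if_neg (by omega)]) ?_ ?_
  · rw [PowerSeries.isRestricted_iff']
    have hlt : ((q : ℝ) ^ q)⁻¹ * ρ < 1 := by
      rw [inv_mul_lt_iff₀ (by positivity), mul_one]
      exact hρ'
    have ht := (tendsto_pow_atTop_nhds_zero_of_lt_one (by positivity) hlt).const_mul b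
    rw [mul_zero] at ht
    refine squeeze_zero' (Eventually.of_forall fun n => by positivity) ?_ ht
    filter_upwards [hb] with n hn
    rw [map_sub, mul_pow, ← mul_assoc]
    gcongr
    simpa only [G, PowerSeries.coeff_mk] using hn
  · rw [mul_sub, hG]
    abel

end TModule

end PeriodResidue

end

/-! ### Conclusion -/

namespace PeriodResidue

open Matrix

theorem ratToLaurent_algebraMap (K C : Type*) [Field K] [NormedField C] [Algebra K C]
    (a : K[X]) : ratToLaurent K C (algebraMap K[X] (RatFunc K) a) =
      HahnSeries.ofPowerSeries ℤ C (polyToSeries K C a) := by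
  rw [ratToLaurent, RatFunc.liftRingHom_algebraMap]
  rfl

theorem TModule.lieCoord_neg {Fq K C : Type*} [Field Fq] [Fintype Fq] [Field K]
    [Algebra (RatFunc Fq) K] {d : ℕ} {E : TModule Fq K d} [NormedField C] [Algebra K C]
    (κ : Fin d → E.Motive) (x : E.Lie C) (i : Fin d) :
    E.lieCoord κ (-x) i = -((fun j => algebraMap K C
      (MvPolynomial.coeff (Finsupp.single j 1) (κ i).poly)) ⬝ᵥ x) :=
  congrFun (mulVec_neg (show Fin d → C from x)
    ((differential fun i => (κ i).poly).map (algebraMap K C))) i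

end PeriodResidue

theorem mainTheorem6 {Fq K : Type*} [Field Fq] [Fintype Fq] [Field K] [Algebra (RatFunc Fq) K]
    [FiniteDimensional (RatFunc Fq) K] (P : InftyAbs Fq K) {d r : ℕ} (E : TModule Fq K d)
    (m : Module.Basis (Fin r) K[X] E.Motive)
    (Θ : Matrix (Fin r) (Fin r) K[X])
    (hΘ : ∀ i, E.tau (m i) = ∑ j, Θ i j • m j)
    (Υ : GL (Fin r) (tate (CInf P)))
    (hΥ : (Υ.val.map fun f => twist (Fintype.card Fq) f.val) *
        Θ.map (fun a => ((a.map (algebraMap K (CInf P)) : (CInf P)[X]) : (CInf P)⟦X⟧)) =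
      Υ.val.map Subtype.val)
    (κ : Fin d → E.Motive) (hκ : E.IsCoordinateSystem κ)
    (A' : Matrix (Fin d) (Fin r) (RatFunc K))
    (hA' : ∀ j, ∃ γ : ℕ, 0 < γ ∧ ∃ i : Fin r,
      A' j = Pi.single i ((RatFunc.X - RatFunc.C (theta Fq K)) ^ (-(γ : ℤ))))
    (B : GL (Fin r) K[X])
    (A : Matrix (Fin d) (Fin r) K[X])
    (hA : A.map (algebraMap K[X] (RatFunc K)) =
      A' * (B.val * Θ).map (algebraMap K[X] (RatFunc K)))
    (hκA : ∀ i, κ i = ∑ j, A i j • m j) :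
    ∃ lam : Fin r → E.Lie (CInf P),
      LinearIndependent Fq[X] lam ∧
      (Submodule.span Fq[X] (Set.range lam) : Set (E.Lie (CInf P))) =
        E.periodLattice (CInf P) ∧
      ∀ i j, HasResidueAt
        (((A' * (B.val * Θ).map (algebraMap K[X] (RatFunc K))).map (ratToLaurent K (CInf P)) *
          (Υ⁻¹).val.map fun f => HahnSeries.ofPowerSeries ℤ (CInf P) f.val) i j)
        (algebraMap K (CInf P) (theta Fq K)) (E.lieCoord κ (lam j) i) := by
  let _ : Algebra Fq K := ((algebraMap (RatFunc Fq) K).comp (algebraMap Fq (RatFunc Fq))).toAlgebra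
  let _ : Algebra Fq (CInf P) := ((algebraMap K (CInf P)).comp (algebraMap Fq K)).toAlgebra
  have : IsScalarTower Fq (RatFunc Fq) K := IsScalarTower.of_algebraMap_eq fun _ => rfl
  have : IsScalarTower Fq K (CInf P) := IsScalarTower.of_algebraMap_eq fun _ => rfl
  have hθ : ‖algebraMap K (CInf P) (theta Fq K)‖ = Fintype.card Fq := by
    rw [norm_algebraMap_CInf, P.abv_theta]
  obtain ⟨l, hli, hspan, hl, hagf⟩ := E.exists_basis_periodLattice P hθ m hΘ Υ hΥ
  -- The residue of a generating function is minus the coordinate of its period, whence the change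
  -- of sign.
  refine ⟨-l, hli.neg, ?_, fun i j => ?_⟩
  · rw [← hspan, ← Set.neg_range', Submodule.span_neg]
  · have hentry : ((A' * (B.val * Θ).map (algebraMap K[X] (RatFunc K))).map
        (ratToLaurent K (CInf P)) *
          (Υ⁻¹).val.map fun f => HahnSeries.ofPowerSeries ℤ (CInf P) f.val) i j =
        HahnSeries.ofPowerSeries ℤ (CInf P) (E.agf (l j) (κ i)) := by
      rw [← hA, hκA, E.agf_sum_smul P hθ (hl j), map_sum, Matrix.mul_apply]
      refine Finset.sum_congr rfl fun k _ => ?_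
      rw [map_mul, hagf]
      simp only [Matrix.map_apply, ratToLaurent_algebraMap]
    rw [hentry]
    have hres := E.hasResidueAt_agf P hθ (l j) (κ i)
    rw [Pi.neg_apply, TModule.lieCoord_neg]
    exact hres
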